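/- Let $X\subset\mathbb P^3=\mathbb P^3(\mathbb C)$ be an irreducible Zariski-closed algebraic curve that is not a line. Let $X^*\subset\mathbb P^{3*}$ be its dual variety, i.e. the Zariski closure of the set of planes that contain the tangent line of $X$ at some smooth point of $X$. Then $X^*$ is a hypersurface, i.e. it is the zero set of some nonzero homogeneous polynomial; let $\Upsilon$ be any nonzero homogeneous polynomial of minimal degree whose zero set is $X^*$. There is an integer $m$, depending only on $X$, and a nonempty Zariski-open set $U\subset\mathbb P^3$ such that for every centre $O\in U$ one has $O\notin X$ and, for every projection $\pi:\mathbb P^3\setminus\{O\}\to\mathbb P^2$ with centre $O$ (given by a $3\times 4$ complex matrix with kernel $O$), the image $\pi(X)$ is an irreducible closed plane curve of class $m$. Here the class of a plane curve $Y$ is the degree of its dual curve $Y^*\subset\mathbb P^{2*}$ (the Zariski closure of the set of tangent lines at smooth points of $Y$), i.e. the least degree of a nonzero homogeneous polynomial with zero set $Y^*$. Moreover $$\deg\Upsilon=m .$$ In particular the class of the projection of $X$ is constant for generic centres. -/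

import Mathlib

noncomputable section

namespace SpaceCurve

/-- Complex projective space `ℙⁿ`, with homogeneous coordinates indexed by `Fin (n + 1)`. A point of
the dual space `ℙⁿ*` is written by the coefficients `a` of the hyperplane `∑ aᵢ xᵢ = 0`. -/
abbrev PSpace (n : ℕ) : Type := Projectivization ℂ (Fin (n + 1) → ℂ)

/-- The (punctured) affine cone over a subset of `ℙⁿ`. -/
def cone {n : ℕ} (S : Set (PSpace n)) : Set (Fin (n + 1) → ℂ) :=
  {v | ∃ h : v ≠ 0, Projectivization.mk ℂ v h ∈ S}

/-- The homogeneous ideal of a subset of `ℙⁿ`: all polynomials that vanish on its cone. (As the cone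
is stable under scaling and `ℂ` is infinite, this ideal is generated by homogeneous polynomials.) -/
def idealOf {n : ℕ} (S : Set (PSpace n)) : Ideal (MvPolynomial (Fin (n + 1)) ℂ) :=
  MvPolynomial.vanishingIdeal ℂ (cone S)

/-- The Zariski closure of a subset of `ℙⁿ`. -/
def zariskiClosure {n : ℕ} (S : Set (PSpace n)) : Set (PSpace n) :=
  {p | ∀ f ∈ idealOf S, MvPolynomial.eval p.rep f = 0}

/-- The Krull dimension of the homogeneous coordinate ring of `X`, that is `dim X + 1`. -/
def coneDim {n : ℕ} (X : Set (PSpace n)) : WithBot ℕ∞ :=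
  ringKrullDim (MvPolynomial (Fin (n + 1)) ℂ ⧸ idealOf X)

/-- `X ⊆ ℙⁿ` is an irreducible Zariski-closed algebraic curve. -/
structure IsIrreducibleCurve {n : ℕ} (X : Set (PSpace n)) : Prop where
  closed : zariskiClosure X = X
  irreducible : (idealOf X).IsPrime
  dim_eq_one : coneDim X = 2

/-- `X ⊆ ℙⁿ` is a (projective) line. -/
def IsLine {n : ℕ} (X : Set (PSpace n)) : Prop :=
  ∃ L : Submodule ℂ (Fin (n + 1) → ℂ), Module.finrank ℂ L = 2 ∧ X = {p | p.submodule ≤ L}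

/-- The embedded projective tangent space of `X` at `p`, as a linear subspace of `ℂⁿ⁺¹`. -/
def tangentSpace {n : ℕ} (X : Set (PSpace n)) (p : PSpace n) :
    Submodule ℂ (Fin (n + 1) → ℂ) where
  carrier := {w | ∀ f ∈ idealOf X, ∑ i, MvPolynomial.eval p.rep (MvPolynomial.pderiv i f) * w i = 0}
  add_mem' := by
    intro a b ha hb f hf
    simp only [Pi.add_apply, mul_add, Finset.sum_add_distrib, ha f hf, hb f hf, add_zero]
  zero_mem' := by
    intro f _
    simp
  smul_mem' := by
    intro c a ha f hf
    have h := ha f hf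
    simp only [Pi.smul_apply, smul_eq_mul, mul_left_comm _ c, ← Finset.mul_sum, h, mul_zero]

/-- `p` is a smooth point of the irreducible variety `X`: the tangent space has the dimension
of `X`. -/
def IsSmoothPoint {n : ℕ} (X : Set (PSpace n)) (p : PSpace n) : Prop :=
  p ∈ X ∧ ((Module.finrank ℂ (tangentSpace X p) : ℕ) : WithBot ℕ∞) = coneDim X

/-- The hyperplane with coefficients `a` contains the tangent space of `X` at `p`. -/
def IsTangentAt {n : ℕ} (X : Set (PSpace n)) (p : PSpace n) (a : PSpace n) : Prop :=
  ∀ w ∈ tangentSpace X p, ∑ i, a.rep i * w i = 0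

/-- The dual variety `X* ⊆ ℙⁿ*`: the Zariski closure of the set of hyperplanes that are tangent to
`X` at some smooth point of `X`. -/
def dualVariety {n : ℕ} (X : Set (PSpace n)) : Set (PSpace n) :=
  zariskiClosure {a | ∃ p, IsSmoothPoint X p ∧ IsTangentAt X p a}

/-- `F` is a nonzero homogeneous polynomial whose zero set in `ℙⁿ` is `S`. -/
def Represents {n : ℕ} (F : MvPolynomial (Fin (n + 1)) ℂ) (S : Set (PSpace n)) : Prop :=
  F ≠ 0 ∧ F.IsHomogeneous F.totalDegree ∧ S = {p | MvPolynomial.eval p.rep F = 0}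

/-- `F` is a polynomial of minimal degree that represents the hypersurface `S`. -/
def IsMinimalEquation {n : ℕ} (F : MvPolynomial (Fin (n + 1)) ℂ) (S : Set (PSpace n)) : Prop :=
  Represents F S ∧ ∀ G, Represents G S → F.totalDegree ≤ G.totalDegree

/-- The plane curve `Y` has class `m`: its dual `Y*` is a curve of degree `m`, that is, it has a
minimal equation of degree `m`. -/
def HasClass (Y : Set (PSpace 2)) (m : ℕ) : Prop :=
  ∃ φ : MvPolynomial (Fin 3) ℂ, IsMinimalEquation φ (dualVariety Y) ∧ φ.totalDegree = m

/-- The image of `X` under the projection `p ↦ M p`; points where `M p = 0` have no image. -/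
def projection (M : Matrix (Fin 3) (Fin 4) ℂ) (X : Set (PSpace 3)) : Set (PSpace 2) :=
  {q | ∃ p ∈ X, ∃ h : M.mulVec p.rep ≠ 0, q = Projectivization.mk ℂ (M.mulVec p.rep) h}

/-- `M` is the matrix of a projection with centre `O`: its kernel is exactly `O`. -/
def HasCentre (M : Matrix (Fin 3) (Fin 4) ℂ) (O : PSpace 3) : Prop :=
  LinearMap.ker M.mulVecLin = O.submodule

/-- `P` holds for a generic point of `ℙⁿ`: on a nonempty Zariski-open subset, which is given here as
(or contains) the complement of a hypersurface. -/
def HoldsGenerically {n : ℕ} (P : PSpace n → Prop) : Prop :=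
  ∃ G : MvPolynomial (Fin (n + 1)) ℂ, G ≠ 0 ∧ G.IsHomogeneous G.totalDegree ∧
    ∀ p : PSpace n, MvPolynomial.eval p.rep G ≠ 0 → P p

end SpaceCurve

end

/-!
Let `K` be the function field of the cone over `X`, let `ξ ∈ K⁴` be its generic point and let `N` be
the span in `K⁴` of the gradients at `ξ` of the equations of `X`. The orthogonal complement of `N`
is the space of derivations from the coordinate ring to `K`, so `dim N = 4 - trdeg K = 2`. As smooth
points are dense, a polynomial over `ℂ` vanishes on `X*` if and only if it vanishes on `N`. These
polynomials form a prime ideal of height one, generated by `Υ`, unless `N` has a basis in `ℂ⁴`, in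
which case `X` is a line.

Projecting from a centre `O` that is represented by a generic `o ∈ ℂ⁴` replaces `N` by `N ∩ o⊥`:
the ideal of the dual curve of the projection consists of the polynomials on the plane `o⊥` that
vanish on `N ∩ o⊥`. The restriction of `Υ` to `o⊥` is such a polynomial, so the class of the
projection is `deg Υ` as soon as no nonzero form of smaller degree on `o⊥` vanishes on `N ∩ o⊥`.

For a basis `e, f` of `N` the line `N ∩ ω⊥` is spanned by `(f · ω) e - (e · ω) f`. Along a suitable
pencil of hyperplanes `ω⊥` this vector runs through `e + s f`. If the coordinates of the vector
satisfied a relation of degree `d < deg Υ` on every plane `ω⊥`, then the coefficients of these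
relations along the pencil would combine to a polynomial that vanishes on `N` but is not divisible
by `Υ`. Hence there is no such relation for one `ω`, and then for none in a nonempty open set.
-/

namespace SpaceCurve

open MvPolynomial Module
open scoped TensorProduct

section Dimension

/-! ### Krull dimension, transcendence degree and differentials -/

theorem ringKrullDim_eq_of_injective_of_isIntegral {R S : Type*} [CommRing R] [CommRing S]
    [Algebra R S] [Algebra.IsIntegral R S] (h : Function.Injective (algebraMap R S)) :
    ringKrullDim R = ringKrullDim S := by
  refine le_antisymm (iSup_le fun l => ?_)
    (Order.krullDim_le_of_strictMono (PrimeSpectrum.comap (algebraMap R S)) fun P Q hPQ =>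
      Ideal.IsIntegral.comap_lt_comap hPQ)
  obtain ⟨P, -, _, hP⟩ := Ideal.exists_ideal_over_prime_of_isIntegral (S := S)
    l.head.asIdeal ⊥ (by
      rw [← RingHom.ker_eq_comap_bot, (RingHom.injective_iff_ker_eq_bot _).1 h]
      exact bot_le)
  have : P.LiesOver (RelSeries.head l).asIdeal := ⟨hP.symm⟩
  obtain ⟨L, hL, -⟩ := Ideal.exists_ltSeries_of_hasGoingUp l P
  rw [← hL]
  exact le_iSup (fun p : LTSeries (PrimeSpectrum S) => (p.length : WithBot ℕ∞)) L

theorem exists_ringKrullDim_eq_and_trdeg_eq {k R : Type*} [Field k] [CommRing R]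
    [IsDomain R] [Algebra k R] [Algebra.FiniteType k R] :
    ∃ s : ℕ, ringKrullDim R = s ∧ Algebra.trdeg k R = s := by
  obtain ⟨s, g, hg, hint⟩ := exists_integral_inj_algHom_of_fg k R
  let : Algebra (MvPolynomial (Fin s) k) R := g.toRingHom.toAlgebra
  have : IsScalarTower k (MvPolynomial (Fin s) k) R :=
    .of_algebraMap_eq fun x => (g.commutes x).symm
  have : Algebra.IsIntegral (MvPolynomial (Fin s) k) R := ⟨hint⟩
  have : FaithfulSMul (MvPolynomial (Fin s) k) R :=
    (faithfulSMul_iff_algebraMap_injective _ _).2 hg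
  refine ⟨s, ?_, ?_⟩
  · rw [← ringKrullDim_eq_of_injective_of_isIntegral (R := MvPolynomial (Fin s) k) hg,
      MvPolynomial.ringKrullDim_of_isNoetherianRing, ringKrullDim_eq_zero_of_field]
    simp
  · have h := lift_trdeg_add_eq k (MvPolynomial (Fin s) k) (A := R)
    rw [MvPolynomial.trdeg_of_isDomain, trdeg_eq_zero] at h
    simpa using h.symm

theorem trdeg_eq_of_ringKrullDim_eq {k R : Type*} [Field k] [CommRing R] [IsDomain R]
    [Algebra k R] [Algebra.FiniteType k R] {d : ℕ} (h : ringKrullDim R = d) :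
    Algebra.trdeg k R = d := by
  obtain ⟨s, hs, hs'⟩ := exists_ringKrullDim_eq_and_trdeg_eq (k := k) (R := R)
  rw [hs', Nat.cast_inj.1 (show ((s : ℕ) : WithBot ℕ∞) = (d : ℕ) from hs.symm.trans h)]

theorem isAlgebraic_of_trdeg_le.{u, v} {k : Type*} {A : Type u} {S : Type v} [Field k]
    [CommRing A] [CommRing S] [IsDomain S] [Algebra k A] [Algebra k S] [Algebra A S]
    [IsScalarTower k A S] [FaithfulSMul A S] {d : ℕ} (hA : Algebra.trdeg k A = d)
    (hS : Algebra.trdeg k S ≤ d) : Algebra.IsAlgebraic A S := by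
  have : Nontrivial A := (algebraMap A S).domain_nontrivial
  have h := lift_trdeg_add_eq k A (A := S)
  have hS' := Cardinal.lift_le.{u}.2 hS
  rw [hA, Cardinal.lift_natCast] at h
  rw [Cardinal.lift_natCast, ← h] at hS'
  refine trdeg_eq_zero_iff.1 (Cardinal.lift_eq_zero.1
    (Cardinal.eq_of_add_eq_add_left (a := d) ?_ Cardinal.natCast_lt_aleph0))
  rw [add_zero]
  exact le_antisymm hS' le_self_add

theorem formallyEtale_of_isAlgebraic (A K : Type*) [CommRing A] [IsDomain A] [CharZero A] [Field K]
    [Algebra A K] [FaithfulSMul A K] [Algebra.IsAlgebraic A K] : Algebra.FormallyEtale A K := by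
  let : Algebra (FractionRing A) K := FractionRing.liftAlgebra A K
  have : IsScalarTower A (FractionRing A) K := FractionRing.isScalarTower_liftAlgebra A K
  have : Algebra.IsAlgebraic (FractionRing A) K :=
    (IsFractionRing.comap_isAlgebraic_iff (A := A) (K := FractionRing A)).1 inferInstance
  have : CharZero (FractionRing A) := IsFractionRing.charZero A
  have : Algebra.FormallyEtale A (FractionRing A) := .of_isLocalization (nonZeroDivisors A)
  have : Algebra.FormallyEtale (FractionRing A) K := .of_isSeparable _ _
  exact .comp A (FractionRing A) K

variable {k K : Type*} [Field k] [CharZero k] [Field K] [Algebra k K] {d : ℕ}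

theorem finrank_kaehlerDifferential_eq (hK : Algebra.trdeg k K = d) : finrank K (Ω[K⁄k]) = d := by
  obtain ⟨ι, s, hs⟩ := exists_isTranscendenceBasis' k K
  let : Algebra (MvPolynomial ι k) K := (aeval s).toRingHom.toAlgebra
  have : IsScalarTower k (MvPolynomial ι k) K :=
    .of_algebraMap_eq fun x => ((aeval (R := k) s).commutes x).symm
  have : FaithfulSMul (MvPolynomial ι k) K := (faithfulSMul_iff_algebraMap_injective _ _).2 hs.1
  have : Algebra.IsAlgebraic (MvPolynomial ι k) K :=
    hs.isAlgebraic_iff.2 fun i => by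
      simpa [RingHom.algebraMap_toAlgebra] using
        isAlgebraic_algebraMap (R := MvPolynomial ι k) (A := K) (X i)
  have := formallyEtale_of_isAlgebraic (MvPolynomial ι k) K
  rw [← (KaehlerDifferential.tensorKaehlerEquivOfFormallyEtale k (MvPolynomial ι k) K).finrank_eq,
    finrank_eq_nat_card_basis ((KaehlerDifferential.mvPolynomialBasis k ι).baseChange K),
    Nat.card, hs.cardinalMk_eq_trdeg, hK, Cardinal.toNat_natCast]

theorem finrank_kaehlerDifferential_linearMap_eq (R : Type*) [CommRing R] [IsDomain R] [Algebra k R]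
    [Algebra R K] [IsScalarTower k R K] [FaithfulSMul R K] [Algebra.IsAlgebraic R K]
    (hK : Algebra.trdeg k K = d) : finrank K (Ω[R⁄k] →ₗ[R] K) = d := by
  have : CharZero R := Algebra.charZero_of_charZero k R
  have := formallyEtale_of_isAlgebraic R K
  rw [(LinearMap.liftBaseChangeEquiv (R := R) (M := Ω[R⁄k]) (N := K) K).finrank_eq,
    ← finrank_kaehlerDifferential_eq hK,
    ← (KaehlerDifferential.tensorKaehlerEquivOfFormallyEtale k R K).finrank_eq]
  exact Subspace.dual_finrank_eq

end Dimension

section Perp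

/-! ### Conormal spaces -/

variable {K σ : Type*} [Field K] [Fintype σ]

/-- The annihilator of a subspace of `σ → K` for the standard bilinear form: it turns a space of
hyperplanes into the common zeros of these hyperplanes, and conversely. -/
def perp (N : Submodule K (σ → K)) : Submodule K (σ → K) :=
  LinearMap.BilinForm.orthogonal (dotProductBilin K K) N

theorem mem_perp {N : Submodule K (σ → K)} {w : σ → K} : w ∈ perp N ↔ ∀ a ∈ N, a ⬝ᵥ w = 0 := Iff.rfl

theorem mem_perp_span {s : Set (σ → K)} {w : σ → K} :
    w ∈ perp (Submodule.span K s) ↔ ∀ a ∈ s, a ⬝ᵥ w = 0 := by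
  refine ⟨fun h a ha => h a (Submodule.subset_span ha), fun h => ?_⟩
  have : Submodule.span K s ≤ LinearMap.ker ((dotProductBilin K K).flip w) := Submodule.span_le.2 h
  exact fun a ha => this ha

theorem nondegenerate_dotProductBilin :
    LinearMap.BilinForm.Nondegenerate (dotProductBilin K K : LinearMap.BilinForm K (σ → K)) :=
  ⟨fun _ h => dotProduct_eq_zero_iff.1 h,
    fun _ h => dotProduct_eq_zero_iff.1 fun w => (dotProduct_comm _ w).trans (h w)⟩

theorem finrank_perp (N : Submodule K (σ → K)) :
    finrank K (perp N) = Fintype.card σ - finrank K N := by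
  rw [perp, LinearMap.BilinForm.finrank_orthogonal nondegenerate_dotProductBilin,
    finrank_fintype_fun_eq_card]

theorem perp_perp (N : Submodule K (σ → K)) : perp (perp N) = N :=
  LinearMap.BilinForm.orthogonal_orthogonal nondegenerate_dotProductBilin
    (fun _ _ h => (dotProduct_comm _ _).trans h) N

end Perp

section Conormal

variable {k K σ : Type*} [Field k] [Field K] [Algebra k K]

/-- The gradient of a polynomial at the point `ξ`, whose coordinates may lie in an extension of the
field of coefficients. -/
noncomputable def gradAt (ξ : σ → K) : MvPolynomial σ k →ₗ[k] σ → K :=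
  LinearMap.pi fun i => (aeval ξ).toLinearMap ∘ₗ (pderiv i).toLinearMap

/-- The span of the gradients at `ξ` of the elements of `I`, i.e. the conormal space at `ξ` of the
cone defined by `I`: the hyperplanes that contain the tangent space there. -/
noncomputable def conormal (I : Ideal (MvPolynomial σ k)) (ξ : σ → K) : Submodule K (σ → K) :=
  Submodule.span K (gradAt ξ '' (I : Set (MvPolynomial σ k)))

theorem gradAt_apply (ξ : σ → K) (f : MvPolynomial σ k) (i : σ) :
    gradAt ξ f i = aeval ξ (pderiv i f) := rfl

variable [Fintype σ]

theorem derivation_aeval {R A M σ : Type*} [CommRing R] [CommRing A] [Algebra R A] [AddCommGroup M]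
    [Module R M] [Module A M] [Fintype σ] (δ : Derivation R A M) (x : σ → A)
    (f : MvPolynomial σ R) : δ (aeval x f) = ∑ i, aeval x (pderiv i f) • δ (x i) := by
  classical
  induction f using MvPolynomial.induction_on with
  | C a => simp
  | add f g hf hg => simp only [map_add, hf, hg, add_smul, Finset.sum_add_distrib]
  | mul_X f j hf =>
    simp only [map_mul, aeval_X, Derivation.leibniz, hf, pderiv_X, Pi.single_apply, smul_eq_mul,
      map_add, add_smul, mul_smul, Finset.sum_add_distrib, Finset.smul_sum]
    simp

variable {I : Ideal (MvPolynomial σ k)} [Algebra (MvPolynomial σ k ⧸ I) K] {ξ : σ → K}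

theorem derivation_mk_eq_gradAt_dotProduct
    (hξ : ∀ f, algebraMap (MvPolynomial σ k ⧸ I) K (Ideal.Quotient.mk I f) = aeval ξ f)
    (δ : Derivation k (MvPolynomial σ k ⧸ I) K) (f : MvPolynomial σ k) :
    δ (Ideal.Quotient.mk I f) = gradAt ξ f ⬝ᵥ fun i => δ (Ideal.Quotient.mk I (X i)) := by
  have hmk (g : MvPolynomial σ k) :
      aeval (fun i => Ideal.Quotient.mk I (X i)) g = Ideal.Quotient.mk I g :=
    (aeval_unique (Ideal.Quotient.mkₐ k I) ▸ rfl)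
  rw [← hmk, derivation_aeval]
  simp only [hmk, Algebra.smul_def, hξ]
  rfl

theorem exists_derivation_mk_X_eq_of_mem_perp_conormal
    (hξ : ∀ f, algebraMap (MvPolynomial σ k ⧸ I) K (Ideal.Quotient.mk I f) = aeval ξ f)
    {w : σ → K} (hw : w ∈ perp (conormal I ξ)) :
    ∃ δ : Derivation k (MvPolynomial σ k ⧸ I) K, ∀ i, δ (Ideal.Quotient.mk I (X i)) = w i := by
  let : Algebra (MvPolynomial σ k) K := (aeval (R := k) ξ).toAlgebra
  have : IsScalarTower k (MvPolynomial σ k) K :=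
    .of_algebraMap_eq fun x => ((aeval (R := k) ξ).commutes x).symm
  have : IsScalarTower (MvPolynomial σ k) (MvPolynomial σ k ⧸ I) K :=
    .of_algebraMap_eq fun x => (hξ x).symm
  let δ := mkDerivation k w
  have hδ : I.restrictScalars k ≤ LinearMap.ker δ.toLinearMap := fun f hf => by
    have h := derivation_aeval δ X f
    simp only [δ, mkDerivation_X, aeval_X_left_apply] at h
    exact h.trans (mem_perp_span.1 hw _ ⟨f, hf, rfl⟩)
  refine ⟨Derivation.mk' ((I.restrictScalars k).liftQ δ.toLinearMap hδ) ?_, mkDerivation_X k w⟩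
  rintro ⟨f⟩ ⟨g⟩
  exact (δ.leibniz f g).trans
    (congrArg₂ (· + ·) (algebraMap_smul _ f (δ g)).symm (algebraMap_smul _ g (δ f)).symm)

variable [IsScalarTower k (MvPolynomial σ k ⧸ I) K]

theorem finrank_perp_conormal_eq_finrank_kaehlerDifferential_linearMap
    (hξ : ∀ f, algebraMap (MvPolynomial σ k ⧸ I) K (Ideal.Quotient.mk I f) = aeval ξ f) :
    finrank K (perp (conormal I ξ)) =
      finrank K (Ω[(MvPolynomial σ k ⧸ I)⁄k] →ₗ[MvPolynomial σ k ⧸ I] K) := by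
  let R := MvPolynomial σ k ⧸ I
  let Φ : (Ω[R⁄k] →ₗ[R] K) →ₗ[K] (σ → K) :=
    { toFun := fun l i => l (KaehlerDifferential.D k R (Ideal.Quotient.mk I (X i)))
      map_add' := fun _ _ => rfl
      map_smul' := fun _ _ => rfl }
  have hΦ (l : Ω[R⁄k] →ₗ[R] K) (f : MvPolynomial σ k) :
      l (KaehlerDifferential.D k R (Ideal.Quotient.mk I f)) = gradAt ξ f ⬝ᵥ Φ l :=
    derivation_mk_eq_gradAt_dotProduct hξ (l.compDer (KaehlerDifferential.D k R)) f
  have hinj : Function.Injective Φ := (injective_iff_map_eq_zero Φ).2 fun l hl => by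
    apply LinearMap.ext_on (KaehlerDifferential.span_range_derivation k R)
    rintro _ ⟨y, rfl⟩
    obtain ⟨f, rfl⟩ := Ideal.Quotient.mk_surjective y
    rw [hΦ, hl, dotProduct_zero, LinearMap.zero_apply]
  have hrange : LinearMap.range Φ = perp (conormal I ξ) := by
    ext w
    constructor
    · rintro ⟨l, rfl⟩
      refine mem_perp_span.2 ?_
      rintro _ ⟨f, hf, rfl⟩
      rw [← hΦ, Ideal.Quotient.eq_zero_iff_mem.2 hf, map_zero, map_zero]
    · intro hw
      obtain ⟨δ, hδ⟩ := exists_derivation_mk_X_eq_of_mem_perp_conormal hξ hw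
      refine ⟨δ.liftKaehlerDifferential, funext fun i => ?_⟩
      exact (δ.liftKaehlerDifferential_comp_D _).trans (hδ i)
  rw [← hrange, LinearMap.finrank_range_of_inj hinj]

end Conormal

theorem finrank_perp_conormal {k K σ : Type*} [Field k] [CharZero k] [Field K] [Algebra k K]
    [Fintype σ] {I : Ideal (MvPolynomial σ k)} {ξ : σ → K} (hI : I = vanishingIdeal k {ξ}) {d : ℕ}
    (hK : Algebra.trdeg k K = d) (hdim : ringKrullDim (MvPolynomial σ k ⧸ I) = d) :
    finrank K (perp (conormal I ξ)) = d := by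
  have : I.IsPrime := hI ▸ inferInstance
  let R := MvPolynomial σ k ⧸ I
  have hker (f : MvPolynomial σ k) : f ∈ I ↔ aeval ξ f = 0 := by
    rw [hI, mem_vanishingIdeal_singleton_iff]
  let φ : R →ₐ[k] K := Ideal.Quotient.liftₐ I (aeval ξ) fun f hf => (hker f).1 hf
  let : Algebra R K := φ.toAlgebra
  have : IsScalarTower k R K := .of_algebraMap_eq fun x => (φ.commutes x).symm
  have : FaithfulSMul R K := by
    refine (faithfulSMul_iff_algebraMap_injective _ _).2 ((injective_iff_map_eq_zero _).2 ?_)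
    rintro ⟨f⟩ hf
    exact Ideal.Quotient.eq_zero_iff_mem.2 ((hker f).2 hf)
  have : Algebra.IsAlgebraic R K :=
    isAlgebraic_of_trdeg_le (trdeg_eq_of_ringKrullDim_eq hdim) hK.le
  rw [finrank_perp_conormal_eq_finrank_kaehlerDifferential_linearMap fun _ => rfl,
    finrank_kaehlerDifferential_linearMap_eq _ hK]

section Minors

/-! ### Minors -/

theorem exists_det_ne_zero_of_linearIndependent {A ι : Type*} [CommRing A] [IsDomain A] {r : ℕ}
    (F : Fin r → ι → A) (hF : LinearIndependent A F) :
    ∃ c : Fin r → ι, (Matrix.of fun i j => F i (c j)).det ≠ 0 := by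
  induction r with
  | zero => exact ⟨Fin.elim0, by simp⟩
  | succ r ih =>
    obtain ⟨c, hc⟩ := ih (fun i => F i.succ) (hF.comp _ (Fin.succ_injective r))
    by_contra! hdet
    -- Were all minors extending the given one zero, their Laplace expansions along the first
    -- column would be a linear relation between the rows.
    let g : Fin (r + 1) → A := fun i =>
      (-1) ^ (i : ℕ) * (Matrix.of fun k j => F (i.succAbove k) (c j)).det
    have hg : ∑ i, g i • F i = 0 := by
      ext j
      rw [Finset.sum_apply, Pi.zero_apply, ← hdet (Fin.cons j c), Matrix.det_succ_column_zero]
      refine Finset.sum_congr rfl fun i _ => ?_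
      simp only [g, Pi.smul_apply, smul_eq_mul, Matrix.of_apply, Fin.cons_zero]
      rw [mul_right_comm]
      rfl
    have hg0 := Fintype.linearIndependent_iff.1 hF g hg 0
    exact hc (by simpa [g] using hg0)

theorem linearIndependent_of_det_ne_zero {K ι : Type*} [Field K] {r : ℕ} {F : Fin r → ι → K}
    (c : Fin r → ι) (h : (Matrix.of fun i j => F i (c j)).det ≠ 0) : LinearIndependent K F :=
  .of_comp (LinearMap.funLeft K K c) (Matrix.linearIndependent_rows_of_det_ne_zero h)

end Minors

section Homogeneous

/-! ### Homogeneous components -/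

variable {k A σ : Type*} [CommRing k] [CommRing A] [Algebra k A]

theorem aeval_smul_of_isHomogeneous {f : MvPolynomial σ k} {d : ℕ} (hf : f.IsHomogeneous d)
    (a : σ → A) (t : A) : aeval (t • a) f = t ^ d * aeval a f := by
  rw [aeval_def, aeval_def, eval₂_eq, eval₂_eq, Finset.mul_sum]
  refine Finset.sum_congr rfl fun m hm => ?_
  have hd : ∑ i ∈ m.support, m i = d := hf.degree_eq_sum_deg_support hm |>.symm
  simp only [Pi.smul_apply, smul_eq_mul, mul_pow, Finset.prod_mul_distrib,
    Finset.prod_pow_eq_pow_sum, hd]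
  ring

theorem aeval_smul_eq_sum (f : MvPolynomial σ k) (a : σ → A) (t : A) :
    aeval (t • a) f =
      ∑ d ∈ Finset.range (f.totalDegree + 1), t ^ d * aeval a (homogeneousComponent d f) := by
  conv_lhs => rw [← sum_homogeneousComponent f, map_sum]
  exact Finset.sum_congr rfl fun d _ =>
    aeval_smul_of_isHomogeneous (homogeneousComponent_isHomogeneous d f) a t

theorem polynomial_eq_zero_of_forall_eval_algebraMap_eq_zero (k : Type*) {K : Type*} [Field k]
    [Infinite k] [CommRing K] [IsDomain K] [Algebra k K] {p : Polynomial K}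
    (h : ∀ t : k, t ≠ 0 → p.eval (algebraMap k K t) = 0) : p = 0 := by
  apply Polynomial.eq_zero_of_infinite_isRoot
  have hinf : ({0}ᶜ : Set k).Infinite := (Set.finite_singleton 0).infinite_compl
  refine (hinf.image (algebraMap k K).injective.injOn).mono ?_
  rintro _ ⟨t, ht, rfl⟩
  exact h t ht

theorem aeval_homogeneousComponent_eq_zero {k K : Type*} [Field k] [Infinite k] [CommRing K]
    [IsDomain K] [Algebra k K] {f : MvPolynomial σ k} {a : σ → K}
    (h : ∀ t : k, t ≠ 0 → aeval (algebraMap k K t • a) f = 0) (d : ℕ) :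
    aeval a (homogeneousComponent d f) = 0 := by
  let p : Polynomial K := ∑ e ∈ Finset.range (f.totalDegree + 1),
    Polynomial.C (aeval a (homogeneousComponent e f)) * Polynomial.X ^ e
  have hp : p = 0 := polynomial_eq_zero_of_forall_eval_algebraMap_eq_zero k fun t ht => by
    simp only [p, Polynomial.eval_finsetSum, Polynomial.eval_mul, Polynomial.eval_C,
      Polynomial.eval_pow, Polynomial.eval_X]
    simp only [← h t ht, aeval_smul_eq_sum, mul_comm]
  by_cases hd : d < f.totalDegree + 1
  · have hcoeff := congrArg (Polynomial.coeff · d) hp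
    simpa only [p, Polynomial.finsetSum_coeff, Polynomial.coeff_C_mul, Polynomial.coeff_X_pow,
      mul_ite, mul_one, mul_zero, Finset.sum_ite_eq, Finset.mem_range, hd, if_true,
      Polynomial.coeff_zero] using hcoeff
  · rw [homogeneousComponent_eq_zero _ _ (by lia), map_zero]

theorem isHomogeneous_of_homogeneousComponent_mem_span_singleton [IsDomain k]
    {f : MvPolynomial σ k} (h : ∀ d, homogeneousComponent d f ∈ Ideal.span {f}) :
    f.IsHomogeneous f.totalDegree := by
  have hzero (d : ℕ) (hd : d ≠ f.totalDegree) : homogeneousComponent d f = 0 := by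
    rcases lt_or_gt_of_ne hd with hd | hd
    · by_contra h0
      have hle := totalDegree_le_of_dvd_of_isDomain (Ideal.mem_span_singleton.1 (h d)) h0
      have hle' := (homogeneousComponent_isHomogeneous d f).totalDegree_le
      lia
    · exact homogeneousComponent_eq_zero _ _ hd
  have hf : homogeneousComponent f.totalDegree f = f := by
    conv_rhs => rw [← sum_homogeneousComponent f]
    rw [Finset.sum_eq_single f.totalDegree (fun d _ hd => hzero d hd) (by simp)]
  have hhom := homogeneousComponent_isHomogeneous f.totalDegree f
  rwa [hf] at hhom

end Homogeneous

section Pullback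

/-! ### Linear substitutions -/

variable {R m n : Type*} [CommRing R] [Fintype n]

/-- Substitution of the linear forms given by the rows of `M`, i.e. composition of polynomial
functions with the linear map of `M`. -/
noncomputable def pullback (M : Matrix m n R) : MvPolynomial m R →ₐ[R] MvPolynomial n R :=
  bind₁ M.toMvPolynomial

theorem aeval_pullback {A : Type*} [CommRing A] [Algebra R A] (M : Matrix m n R)
    (f : MvPolynomial m R) (a : n → A) :
    aeval a (pullback M f) = aeval ((M.map (algebraMap R A)).mulVec a) f := by
  rw [pullback, aeval_bind₁]
  congr 2
  ext i
  simp [Matrix.toMvPolynomial, Matrix.mulVec, dotProduct, aeval_monomial]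

theorem eval_pullback (M : Matrix m n R) (f : MvPolynomial m R) (a : n → R) :
    eval a (pullback M f) = eval (M.mulVec a) f :=
  aeval_pullback (A := R) M f a

theorem isHomogeneous_pullback (M : Matrix m n R) {f : MvPolynomial m R} {d : ℕ}
    (hf : f.IsHomogeneous d) : (pullback M f).IsHomogeneous d := by
  have h := hf.aeval M.toMvPolynomial M.toMvPolynomial_isHomogeneous
  rwa [one_mul] at h

theorem pullback_one [DecidableEq n] (f : MvPolynomial n R) : pullback 1 f = f := by
  rw [pullback, Matrix.toMvPolynomial_one, bind₁_X_left, AlgHom.id_apply]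

theorem pullback_pullback {l : Type*} [Fintype m] (A : Matrix m n R) (B : Matrix l m R)
    (f : MvPolynomial l R) : pullback A (pullback B f) = pullback (B * A) f := by
  rw [pullback, pullback, pullback, bind₁_bind₁]
  congr 2
  ext1 i
  exact (Matrix.toMvPolynomial_mul _ _ _).symm

theorem pullback_injective [Finite m] [DecidableEq m] {A : Matrix m n R} {B : Matrix n m R}
    (hAB : A * B = 1) : Function.Injective (pullback A) := by
  have := Fintype.ofFinite m
  refine Function.LeftInverse.injective (g := pullback B) fun f => ?_
  rw [pullback_pullback, hAB, pullback_one]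

theorem pderiv_pullback [Fintype m] (M : Matrix m n R) (f : MvPolynomial m R) (j : n) :
    pderiv j (pullback M f) = ∑ i, C (M i j) * pullback M (pderiv i f) := by
  classical
  have hlin (i : m) : pderiv j (M.toMvPolynomial i) = C (M i j) := by
    simp [Matrix.toMvPolynomial, ← C_mul_X_eq_monomial, pderiv_X, Pi.single_apply]
  refine (derivation_aeval (pderiv j) M.toMvPolynomial f).trans (Finset.sum_congr rfl fun i _ => ?_)
  rw [hlin, smul_eq_mul, mul_comm]
  rfl

theorem gradAt_pullback {k K : Type*} [Field k] [Field K] [Algebra k K] [Fintype m]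
    (M : Matrix m n k) (f : MvPolynomial m k) (ξ : n → K) :
    gradAt ξ (pullback M f) = (M.map (algebraMap k K)).transpose.mulVec
      (gradAt ((M.map (algebraMap k K)).mulVec ξ) f) := by
  ext j
  simp [gradAt_apply, pderiv_pullback, aeval_pullback, Matrix.mulVec, dotProduct]

end Pullback

section VanishingIdeal

/-! ### Polynomials that vanish on a linear subspace over an extension field -/

variable {k K σ ι : Type*} [Field k] [Field K] [Algebra k K] [Fintype ι]

theorem eval_aeval_toMvPolynomial (A : Matrix σ ι K) (f : MvPolynomial σ k) (s : ι → K) :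
    eval s (aeval A.toMvPolynomial f) = aeval (A.mulVec s) f := by
  rw [← aeval_map_algebraMap K, ← aeval_map_algebraMap K (A.mulVec s)]
  exact eval_pullback A _ s

theorem vanishingIdeal_range_mulVecLin [Infinite K] (A : Matrix σ ι K) :
    vanishingIdeal k (LinearMap.range A.mulVecLin : Set (σ → K)) =
      RingHom.ker (aeval (R := k) A.toMvPolynomial) := by
  ext f
  rw [mem_vanishingIdeal_iff, RingHom.mem_ker]
  constructor
  · refine fun h => MvPolynomial.funext fun s => ?_
    rw [eval_aeval_toMvPolynomial, map_zero]
    exact h _ ⟨s, rfl⟩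
  · rintro h _ ⟨s, rfl⟩
    rw [Matrix.mulVecLin_apply, ← eval_aeval_toMvPolynomial, h, map_zero]

theorem vanishingIdeal_span_range [Infinite K] (v : ι → σ → K) :
    vanishingIdeal k (Submodule.span K (Set.range v) : Set (σ → K)) =
      RingHom.ker (aeval (R := k) (Matrix.of v).transpose.toMvPolynomial) := by
  rw [← vanishingIdeal_range_mulVecLin, Matrix.range_mulVecLin]
  rfl

theorem isPrime_vanishingIdeal_submodule [Infinite K] [Finite σ] (N : Submodule K (σ → K)) :
    (vanishingIdeal k (N : Set (σ → K))).IsPrime := by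
  obtain ⟨r, v, rfl⟩ := Submodule.fg_iff_exists_fin_generating_family.1 (IsNoetherian.noetherian N)
  rw [vanishingIdeal_span_range]
  exact RingHom.ker_isPrime _

theorem vanishingIdeal_span_submodule [Infinite k] (V : Submodule k (σ → K)) :
    vanishingIdeal k (Submodule.span K (V : Set (σ → K)) : Set (σ → K)) =
      vanishingIdeal k (V : Set (σ → K)) := by
  have : Infinite K := Infinite.of_injective _ (algebraMap k K).injective
  refine le_antisymm (vanishingIdeal_anti_mono Submodule.subset_span) fun f hf a ha => ?_
  obtain ⟨t, htV, ha⟩ := Submodule.mem_span_finite_of_mem_span ha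
  have ht : f ∈ vanishingIdeal k
      (Submodule.span K (Set.range ((↑) : t → σ → K)) : Set (σ → K)) := by
    rw [vanishingIdeal_span_range, RingHom.mem_ker]
    refine MvPolynomial.funext_set (fun _ => Set.range (algebraMap k K))
      (fun _ => Set.infinite_range_of_injective (algebraMap k K).injective) fun s hs => ?_
    choose z hz using fun i => hs i (Set.mem_univ i)
    rw [eval_aeval_toMvPolynomial, map_zero]
    refine hf _ ?_
    rw [Matrix.mulVec_transpose, Matrix.vecMul_eq_sum]
    refine V.sum_mem fun j _ => ?_
    rw [← hz, algebraMap_smul]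
    exact V.smul_mem _ (htV j.2)
  rw [Subtype.range_coe] at ht
  exact ht a ha

end VanishingIdeal

section Projective

/-! ### Ideals of projective sets -/

variable {n : ℕ} {S X : Set (PSpace n)}

theorem smul_mem_cone {v : Fin (n + 1) → ℂ} (hv : v ∈ cone S) {c : ℂ} (hc : c ≠ 0) :
    c • v ∈ cone S := by
  obtain ⟨h0, h⟩ := hv
  refine ⟨smul_ne_zero hc h0, ?_⟩
  convert h using 1
  rw [Projectivization.mk_eq_mk_iff']
  exact ⟨c, rfl⟩

theorem rep_mem_cone {p : PSpace n} : p.rep ∈ cone S ↔ p ∈ S :=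
  ⟨fun ⟨_, h⟩ => by rwa [Projectivization.mk_rep] at h,
    fun h => ⟨p.rep_nonzero, by rwa [Projectivization.mk_rep]⟩⟩

theorem homogeneousComponent_mem_idealOf {f : MvPolynomial (Fin (n + 1)) ℂ} (hf : f ∈ idealOf S)
    (d : ℕ) : homogeneousComponent d f ∈ idealOf S := fun _ hv =>
  aeval_homogeneousComponent_eq_zero (K := ℂ) (fun _ ht => hf _ (smul_mem_cone hv ht)) d

theorem forall_idealOf_eval_smul_eq_zero {v : Fin (n + 1) → ℂ}
    (h : ∀ f ∈ idealOf S, eval v f = 0) (c : ℂ) : ∀ f ∈ idealOf S, eval (c • v) f = 0 := by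
  intro f hf
  rw [← aeval_eq_eval, aeval_smul_eq_sum]
  exact Finset.sum_eq_zero fun d _ =>
    mul_eq_zero_of_right _ (h _ (homogeneousComponent_mem_idealOf hf d))

theorem mk_mem_zariskiClosure {v : Fin (n + 1) → ℂ} (hv : v ≠ 0) :
    Projectivization.mk ℂ v hv ∈ zariskiClosure S ↔ ∀ f ∈ idealOf S, eval v f = 0 := by
  obtain ⟨c, hc⟩ := Projectivization.exists_smul_eq_mk_rep ℂ v hv
  constructor
  · intro h
    rw [← inv_smul_smul c v, hc]
    exact forall_idealOf_eval_smul_eq_zero h _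
  · intro h
    change ∀ f ∈ idealOf S, eval (Projectivization.mk ℂ v hv).rep f = 0
    rw [← hc]
    exact forall_idealOf_eval_smul_eq_zero h _

theorem subset_zariskiClosure (S : Set (PSpace n)) : S ⊆ zariskiClosure S :=
  fun _ hp _ hf => hf _ (rep_mem_cone.2 hp)

theorem idealOf_zariskiClosure (S : Set (PSpace n)) : idealOf (zariskiClosure S) = idealOf S := by
  apply le_antisymm
  · rintro f hf v ⟨h0, hv⟩
    exact hf v ⟨h0, subset_zariskiClosure S hv⟩
  · rintro f hf v ⟨h0, hv⟩
    exact (mk_mem_zariskiClosure h0).1 hv f hf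

theorem mem_cone_iff_of_closed (hS : zariskiClosure S = S) {v : Fin (n + 1) → ℂ} (hv : v ≠ 0) :
    v ∈ cone S ↔ ∀ f ∈ idealOf S, eval v f = 0 := by
  rw [← mk_mem_zariskiClosure hv, hS]
  exact ⟨fun ⟨_, h⟩ => h, fun h => ⟨hv, h⟩⟩

end Projective

section DualVariety

/-! ### The dual variety and conormal spaces -/

theorem mem_conormal_iff_exists_gradAt_eq {k σ : Type*} [Field k] {I : Ideal (MvPolynomial σ k)}
    {v a : σ → k} : a ∈ conormal I v ↔ ∃ f ∈ I, gradAt v f = a := by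
  refine ⟨fun ha => ?_, fun ⟨f, hf, ha⟩ => ha ▸ Submodule.subset_span ⟨f, hf, rfl⟩⟩
  rwa [conormal, ← Submodule.coe_restrictScalars k I, ← Submodule.map_coe, Submodule.span_eq] at ha

variable {n : ℕ} {S X : Set (PSpace n)}

theorem tangentSpace_eq_perp (X : Set (PSpace n)) (p : PSpace n) :
    tangentSpace X p = perp (conormal (idealOf X) p.rep) := by
  ext w
  rw [conormal, mem_perp_span, Set.forall_mem_image]
  rfl

theorem isTangentAt_iff {p a : PSpace n} :
    IsTangentAt X p a ↔ a.rep ∈ conormal (idealOf X) p.rep := by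
  rw [← perp_perp (conormal _ _), ← tangentSpace_eq_perp, mem_perp]
  simp only [dotProduct_comm _ a.rep]
  rfl

theorem exists_gradAt_smul_eq {f : MvPolynomial (Fin (n + 1)) ℂ} (hf : f ∈ idealOf S) {c : ℂ}
    (hc : c ≠ 0) : ∃ g ∈ idealOf S, ∀ v : Fin (n + 1) → ℂ, gradAt (c • v) g = gradAt v f := by
  refine ⟨c • pullback (c⁻¹ • 1) f, (idealOf S).smul_of_tower_mem c fun v hv => ?_, fun v => ?_⟩
  · change eval v _ = 0
    rw [eval_pullback, Matrix.smul_mulVec, Matrix.one_mulVec]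
    exact hf _ (smul_mem_cone hv (inv_ne_zero hc))
  · have hmap : ((c⁻¹ • 1 : Matrix (Fin (n + 1)) (Fin (n + 1)) ℂ).map (algebraMap ℂ ℂ)) =
        c⁻¹ • 1 := Matrix.map_id' _
    rw [map_smul, gradAt_pullback, hmap, Matrix.transpose_smul, Matrix.transpose_one,
      Matrix.smul_mulVec, Matrix.smul_mulVec, Matrix.one_mulVec, Matrix.one_mulVec,
      inv_smul_smul₀ hc, smul_inv_smul₀ hc]

theorem conormal_smul {c : ℂ} (hc : c ≠ 0) (v : Fin (n + 1) → ℂ) :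
    conormal (idealOf S) (c • v) = conormal (idealOf S) v := by
  ext a
  rw [mem_conormal_iff_exists_gradAt_eq, mem_conormal_iff_exists_gradAt_eq]
  constructor
  · rintro ⟨f, hf, rfl⟩
    obtain ⟨g, hg, hgf⟩ := exists_gradAt_smul_eq hf (inv_ne_zero hc)
    exact ⟨g, hg, by rw [← hgf, inv_smul_smul₀ hc]⟩
  · rintro ⟨f, hf, rfl⟩
    obtain ⟨g, hg, hgf⟩ := exists_gradAt_smul_eq hf hc
    exact ⟨g, hg, hgf v⟩

end DualVariety

section GenericPoint

/-! ### Generic points -/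

variable {k σ : Type*} [Field k] (I : Ideal (MvPolynomial σ k))

/-- The function field of the (affine) variety of a prime ideal. -/
abbrev FunctionField : Type _ := FractionRing (MvPolynomial σ k ⧸ I)

/-- The generic point of the variety of a prime ideal, whose coordinates are the classes of the
variables in the function field. -/
noncomputable def genericPoint : σ → FunctionField I :=
  fun i => algebraMap (MvPolynomial σ k ⧸ I) _ (Ideal.Quotient.mk I (X i))

theorem aeval_genericPoint (f : MvPolynomial σ k) :
    aeval (genericPoint I) f =
      algebraMap (MvPolynomial σ k ⧸ I) (FunctionField I) (Ideal.Quotient.mk I f) := by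
  have h : aeval (genericPoint I) =
      (IsScalarTower.toAlgHom k (MvPolynomial σ k ⧸ I) (FunctionField I)).comp
        (Ideal.Quotient.mkₐ k I) := by
    ext i
    exact aeval_X _ i
  rw [h]
  rfl

variable [I.IsPrime]

theorem vanishingIdeal_genericPoint : vanishingIdeal k {genericPoint I} = I := by
  ext f
  rw [mem_vanishingIdeal_singleton_iff, aeval_genericPoint,
    map_eq_zero_iff _ (IsFractionRing.injective _ _), Ideal.Quotient.eq_zero_iff_mem]

theorem trdeg_functionField [Finite σ] {d : ℕ} (hd : ringKrullDim (MvPolynomial σ k ⧸ I) = d) :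
    Algebra.trdeg k (FunctionField I) = d := by
  have : Algebra.IsAlgebraic (MvPolynomial σ k ⧸ I) (FunctionField I) :=
    (IsFractionRing.comap_isAlgebraic_iff (K := FunctionField I)).2 inferInstance
  rw [← trdeg_eq_of_ringKrullDim_eq (k := k) hd,
    ← trdeg_add_eq k (MvPolynomial σ k ⧸ I) (A := FunctionField I),
    trdeg_eq_zero (R := MvPolynomial σ k ⧸ I), add_zero]

theorem exists_aeval_genericPoint_eq_smul {ι : Type*} [Finite ι] (w : ι → FunctionField I) :
    ∃ g ∉ I, ∃ W : ι → MvPolynomial σ k,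
      ∀ i, aeval (genericPoint I) (W i) = aeval (genericPoint I) g * w i := by
  obtain ⟨b, hb⟩ := IsLocalization.exist_integer_multiples_of_finite
    (nonZeroDivisors (MvPolynomial σ k ⧸ I)) w
  obtain ⟨g, hg⟩ := Ideal.Quotient.mk_surjective (b : MvPolynomial σ k ⧸ I)
  choose y hy using hb
  choose W hW using fun i => Ideal.Quotient.mk_surjective (y i)
  refine ⟨g, fun hgI => nonZeroDivisors.ne_zero b.2 ?_, W, fun i => ?_⟩
  · rw [← hg]
    exact Ideal.Quotient.eq_zero_iff_mem.2 hgI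
  · rw [aeval_genericPoint, aeval_genericPoint, hW, hy, hg, Algebra.smul_def]

end GenericPoint

section Semicontinuity

/-! ### Smooth points are dense -/

variable {k K σ : Type*} [Field k] [Field K] [Algebra k K] {I : Ideal (MvPolynomial σ k)}

theorem exists_notMem_forall_finrank_conormal_le [Finite σ] {ξ : σ → K}
    (hI : I = vanishingIdeal k {ξ}) :
    ∃ δ ∉ I, ∀ v : σ → k, eval v δ ≠ 0 →
      finrank K (conormal I ξ) ≤ finrank k (conormal I v) := by
  obtain ⟨a, ha, -, hli⟩ := Submodule.exists_fun_fin_finrank_span_eq K (gradAt (k := k) ξ '' I)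
  choose f hfI hf using ha
  obtain ⟨c, hc⟩ := exists_det_ne_zero_of_linearIndependent a hli
  refine ⟨(Matrix.of fun i j => pderiv (c j) (f i)).det, ?_, fun v hv => ?_⟩
  · intro hmem
    rw [SetLike.ext_iff.1 hI, mem_vanishingIdeal_singleton_iff, AlgHom.map_det] at hmem
    apply hc
    rw [← hmem]
    congr 2
    ext i j
    exact (congrFun (hf i) (c j)).symm
  · rw [RingHom.map_det] at hv
    have hgrad : LinearIndependent k fun i => gradAt v (f i) :=
      linearIndependent_of_det_ne_zero c hv
    rw [conormal, ← Fintype.card_fin (finrank K _), ← finrank_span_eq_card hgrad]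
    refine Submodule.finrank_mono (Submodule.span_mono ?_)
    rintro _ ⟨i, rfl⟩
    exact ⟨f i, hfI i, rfl⟩

variable [Fintype σ]

theorem mem_perp_conormal_of_forall_mem {v w : σ → k} {W : σ → MvPolynomial σ k}
    (hv : v ∈ zeroLocus k I) (hW : ∀ f ∈ I, ∑ i, pderiv i f * W i ∈ I)
    (hw : ∀ i, eval v (W i) = w i) : w ∈ perp (conormal I v) := by
  rw [conormal, mem_perp_span, Set.forall_mem_image]
  intro f hf
  have h := hv _ (hW f hf)
  rw [map_sum] at h
  simp only [map_mul, aeval_eq_eval, hw] at h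
  exact h

theorem exists_notMem_forall_finrank_perp_conormal_le [I.IsPrime] :
    ∃ δ ∉ I, ∀ v ∈ zeroLocus k I, eval v δ ≠ 0 →
      finrank (FunctionField I) (perp (conormal I (genericPoint I))) ≤
        finrank k (perp (conormal I v)) := by
  let ξ := genericPoint I
  have hker (f : MvPolynomial σ k) : f ∈ I ↔ aeval ξ f = 0 := by
    rw [← mem_vanishingIdeal_singleton_iff, vanishingIdeal_genericPoint]
  let b := finBasis (FunctionField I) (perp (conormal I ξ))
  choose g hg W hW using fun j =>
    exists_aeval_genericPoint_eq_smul I (b j : σ → FunctionField I)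
  have hWli : LinearIndependent (FunctionField I) fun j i => aeval ξ (W j i) := by
    have hb : LinearIndependent (FunctionField I) fun j => (b j : σ → FunctionField I) :=
      b.linearIndependent.map' (Submodule.subtype _) (Submodule.ker_subtype _)
    convert hb.units_smul fun j => Units.mk0 (aeval ξ (g j)) (mt (hker _).2 (hg j)) using 1
    ext j i
    exact hW j i
  obtain ⟨c, hc⟩ := exists_det_ne_zero_of_linearIndependent _ hWli
  refine ⟨(Matrix.of fun i j => W i (c j)).det, ?_, fun v hv hδ => ?_⟩
  · rw [hker, AlgHom.map_det]
    exact hc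
  rw [RingHom.map_det] at hδ
  have hWv : LinearIndependent k fun j i => eval v (W j i) := linearIndependent_of_det_ne_zero c hδ
  rw [← Fintype.card_fin (finrank (FunctionField I) _), ← finrank_span_eq_card hWv]
  refine Submodule.finrank_mono (Submodule.span_le.2 ?_)
  rintro _ ⟨j, rfl⟩
  refine mem_perp_conormal_of_forall_mem (W := W j) hv (fun f hf => ?_) fun i => rfl
  have hperp : gradAt ξ f ⬝ᵥ (b j : σ → FunctionField I) = 0 :=
    (b j).2 _ (Submodule.subset_span ⟨f, hf, rfl⟩)
  rw [hker, map_sum, ← mul_eq_zero_of_right (aeval ξ (g j)) hperp, dotProduct, Finset.mul_sum]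
  refine Finset.sum_congr rfl fun i _ => ?_
  rw [map_mul, hW, mul_left_comm, gradAt_apply]

theorem exists_notMem_forall_finrank_perp_conormal_eq [CharZero k] [I.IsPrime] {d : ℕ}
    (hd : ringKrullDim (MvPolynomial σ k ⧸ I) = d) :
    ∃ δ ∉ I, ∀ v ∈ zeroLocus k I, eval v δ ≠ 0 → finrank k (perp (conormal I v)) = d := by
  have hI : I = vanishingIdeal k {genericPoint I} := (vanishingIdeal_genericPoint I).symm
  have hgen := finrank_perp_conormal hI (trdeg_functionField I hd) hd
  obtain ⟨δ₁, hδ₁, hle₁⟩ := exists_notMem_forall_finrank_conormal_le hI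
  obtain ⟨δ₂, hδ₂, hle₂⟩ := exists_notMem_forall_finrank_perp_conormal_le (I := I)
  refine ⟨δ₁ * δ₂, mt (‹I.IsPrime›.mem_or_mem) (not_or.2 ⟨hδ₁, hδ₂⟩), fun v hv hδ => ?_⟩
  rw [map_mul] at hδ
  refine le_antisymm ?_ (hgen ▸ hle₂ v hv (right_ne_zero_of_mul hδ))
  rw [← hgen, finrank_perp, finrank_perp]
  exact Nat.sub_le_sub_left (hle₁ v (left_ne_zero_of_mul hδ)) _

end Semicontinuity

section DualIdeal

/-! ### The ideal of the dual variety -/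

section

variable {k K σ : Type*} [Field k] [Field K] [Algebra k K]

theorem aeval_aeval_pderiv (ξ : σ → K) (f h : MvPolynomial σ k) :
    aeval ξ (aeval (fun i => pderiv i h) f) = aeval (gradAt ξ h) f :=
  comp_aeval_apply (f := fun i => pderiv i h) (aeval ξ) f

theorem mem_vanishingIdeal_conormal_iff [Infinite k] {I : Ideal (MvPolynomial σ k)}
    {ξ : σ → K} (hI : I = vanishingIdeal k {ξ}) {f : MvPolynomial σ k} :
    f ∈ vanishingIdeal k (conormal I ξ : Set (σ → K)) ↔
      ∀ h ∈ I, aeval (fun i => pderiv i h) f ∈ I := by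
  have hV := vanishingIdeal_span_submodule ((I.restrictScalars k).map (gradAt ξ))
  rw [Submodule.map_coe, Submodule.coe_restrictScalars] at hV
  rw [conormal, hV, mem_vanishingIdeal_iff, Set.forall_mem_image]
  refine forall₂_congr fun h _ => ?_
  conv_rhs => rw [hI, mem_vanishingIdeal_singleton_iff, aeval_aeval_pderiv]

theorem aeval_eq_zero_of_forall_mem_ne_zero [Infinite k] {V : Submodule k (σ → k)} (hV : V ≠ ⊥)
    {f : MvPolynomial σ k} (hf : ∀ a ∈ V, a ≠ 0 → aeval a f = 0) {a : σ → k} (ha : a ∈ V) :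
    aeval a f = 0 := by
  rcases eq_or_ne a 0 with rfl | ha0
  · obtain ⟨b, hb, hb0⟩ := Submodule.exists_mem_ne_zero_of_ne_bot hV
    have h := aeval_homogeneousComponent_eq_zero (K := k) (a := b) (fun t ht =>
      hf _ (V.smul_mem t hb) (smul_ne_zero ht hb0)) 0
    rw [homogeneousComponent_zero, aeval_C] at h
    rw [aeval_zero, constantCoeff_eq, h]
  · exact hf a ha ha0

end

variable {n : ℕ} {S X : Set (PSpace n)} {d : ℕ}

theorem eval_eq_zero_of_mem_idealOf_dualVariety (hd : coneDim X = d)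
    {f : MvPolynomial (Fin (n + 1)) ℂ} (hf : f ∈ idealOf (dualVariety X)) {v : Fin (n + 1) → ℂ}
    (hv : v ∈ cone X) (hvd : finrank ℂ (perp (conormal (idealOf X) v)) = d)
    {a : Fin (n + 1) → ℂ} (ha : a ∈ conormal (idealOf X) v) (ha0 : a ≠ 0) : aeval a f = 0 := by
  rw [dualVariety, idealOf_zariskiClosure] at hf
  obtain ⟨hv0, hvX⟩ := hv
  obtain ⟨c, hc⟩ := Projectivization.exists_smul_eq_mk_rep ℂ v hv0
  obtain ⟨e, he⟩ := Projectivization.exists_smul_eq_mk_rep ℂ a ha0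
  have hconormal : conormal (idealOf X) (Projectivization.mk ℂ v hv0).rep =
      conormal (idealOf X) v := hc ▸ conormal_smul c.ne_zero v
  refine hf a ⟨ha0, Projectivization.mk ℂ v hv0, ⟨hvX, ?_⟩, ?_⟩
  · rw [tangentSpace_eq_perp, hconormal, hvd, hd]
  · rw [isTangentAt_iff, hconormal, ← he]
    exact Submodule.smul_mem _ _ ha

theorem mem_idealOf_dualVariety_of_forall_mem {f : MvPolynomial (Fin (n + 1)) ℂ}
    (hf : ∀ h ∈ idealOf X, aeval (fun i => pderiv i h) f ∈ idealOf X) :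
    f ∈ idealOf (dualVariety X) := by
  rw [dualVariety, idealOf_zariskiClosure]
  rintro a ⟨ha0, p, hp, hpa⟩
  obtain ⟨c, hc⟩ := Projectivization.exists_smul_eq_mk_rep ℂ a ha0
  rw [isTangentAt_iff, ← hc, Units.smul_def, Submodule.smul_mem_iff _ c.ne_zero,
    mem_conormal_iff_exists_gradAt_eq] at hpa
  obtain ⟨h, hh, rfl⟩ := hpa
  rw [← aeval_aeval_pderiv]
  exact hf h hh p.rep (rep_mem_cone.2 hp.1)

theorem idealOf_dualVariety {K : Type*} [Field K] [Algebra ℂ K] (hd : coneDim X = d) (hdn : d ≤ n)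
    {ξ : Fin (n + 1) → K} (hξ : idealOf X = vanishingIdeal ℂ {ξ}) :
    idealOf (dualVariety X) =
      vanishingIdeal ℂ (conormal (idealOf X) ξ : Set (Fin (n + 1) → K)) := by
  have hI : (idealOf X).IsPrime := hξ ▸ inferInstance
  ext f
  rw [mem_vanishingIdeal_conormal_iff hξ]
  refine ⟨fun hf h hh => ?_, mem_idealOf_dualVariety_of_forall_mem⟩
  obtain ⟨δ, hδ, hδX⟩ := exists_notMem_forall_finrank_perp_conormal_eq (I := idealOf X) hd
  refine (hI.mem_or_mem (x := δ) fun v hv => ?_).resolve_left hδ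
  rw [map_mul]
  by_cases hδv : aeval v δ = 0
  · exact mul_eq_zero_of_left hδv _
  have hvd := hδX v (fun g hg => hg v hv) hδv
  have hne : conormal (idealOf X) v ≠ ⊥ := by
    intro hbot
    rw [finrank_perp, hbot, finrank_bot, Fintype.card_fin] at hvd
    lia
  rw [aeval_aeval_pderiv]
  exact mul_eq_zero_of_right _ (aeval_eq_zero_of_forall_mem_ne_zero hne
    (fun a ha ha0 => eval_eq_zero_of_mem_idealOf_dualVariety hd hf hv hvd ha ha0)
    (Submodule.subset_span ⟨h, hh, rfl⟩))

end DualIdeal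

section ConormalNeBot

/-! ### The dual variety is a proper subvariety -/

theorem exists_span_range_eq {K V : Type*} [Field K] [AddCommGroup V] [Module K V]
    (N : Submodule K V) [FiniteDimensional K N] :
    ∃ v : Fin (finrank K N) → V, Submodule.span K (Set.range v) = N := by
  refine ⟨N.subtype ∘ finBasis K N, ?_⟩
  rw [Set.range_comp, ← Submodule.map_span, (finBasis K N).span_eq, Submodule.map_top,
    Submodule.range_subtype]

theorem exists_polynomial_forall_mem_eval₂_eq_zero {k K σ : Type*} [Field k] [Infinite k] [Field K]
    [Algebra k K] [Fintype σ] {N : Submodule K (σ → K)}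
    (hN : vanishingIdeal k (N : Set (σ → K)) = ⊥) {d : ℕ} (hK : Algebra.trdeg k K = d)
    (hd : finrank K N + d ≤ Fintype.card σ) (x : K) :
    ∃ p : Polynomial (MvPolynomial σ k), p ≠ 0 ∧
      ∀ a ∈ N, p.eval₂ (aeval (R := k) a : MvPolynomial σ k →+* K) x = 0 := by
  have : Infinite K := Infinite.of_injective _ (algebraMap k K).injective
  obtain ⟨v, hv⟩ := exists_span_range_eq N
  let B := MvPolynomial (Fin (finrank K N)) K
  let φ : MvPolynomial σ k →ₐ[k] B := aeval (Matrix.of v).transpose.toMvPolynomial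
  let : Algebra (MvPolynomial σ k) B := φ.toAlgebra
  have : IsScalarTower k (MvPolynomial σ k) B := .of_algebraMap_eq fun x => (φ.commutes x).symm
  have : FaithfulSMul (MvPolynomial σ k) B := by
    refine (faithfulSMul_iff_algebraMap_injective _ _).2
      ((RingHom.injective_iff_ker_eq_bot (φ : MvPolynomial σ k →+* B)).2 ?_)
    have hker := vanishingIdeal_span_range (k := k) v
    rw [hv, hN] at hker
    exact hker.symm
  have hB : Algebra.trdeg k B ≤ Fintype.card σ := by
    rw [← trdeg_add_eq k K (A := B), hK, MvPolynomial.trdeg_of_isDomain, Cardinal.mk_fin,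
      Cardinal.lift_natCast, add_comm]
    exact_mod_cast hd
  have hA : Algebra.trdeg k (MvPolynomial σ k) = Fintype.card σ := by
    rw [MvPolynomial.trdeg_of_isDomain, Cardinal.mk_fintype, Cardinal.lift_natCast]
  have : Algebra.IsAlgebraic (MvPolynomial σ k) B := isAlgebraic_of_trdeg_le hA hB
  obtain ⟨p, hp0, hp⟩ := this.isAlgebraic (C x)
  refine ⟨p, hp0, fun a ha => ?_⟩
  obtain ⟨s, rfl⟩ : a ∈ LinearMap.range (Matrix.of v).transpose.mulVecLin := by
    rw [Matrix.range_mulVecLin]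
    exact hv.ge ha
  have hcomp : (aeval (R := k) ((Matrix.of v).transpose.mulVec s) : MvPolynomial σ k →+* K) =
      (eval s).comp (algebraMap (MvPolynomial σ k) B) :=
    RingHom.ext fun f => (eval_aeval_toMvPolynomial _ f s).symm
  have h := congrArg (eval s) hp
  rw [Polynomial.aeval_def, Polynomial.hom_eval₂, eval_C, map_zero, ← hcomp] at h
  exact h

theorem aeval_eval₂_pderiv {k K σ : Type*} [Field k] [Field K] [Algebra k K] (ξ : σ → K)
    (h : MvPolynomial σ k) (p : Polynomial (MvPolynomial σ k)) (i : σ) :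
    aeval ξ (p.eval₂ (aeval (R := k) fun j => pderiv j h : MvPolynomial σ k →+* MvPolynomial σ k)
      (MvPolynomial.X i)) =
      p.eval₂ (aeval (R := k) (gradAt ξ h) : MvPolynomial σ k →+* K) (ξ i) := by
  have hcomp : ((aeval ξ : MvPolynomial σ k →ₐ[k] K) : _ →+* K).comp
      (aeval (R := k) fun j => pderiv j h : MvPolynomial σ k →+* MvPolynomial σ k) =
      (aeval (R := k) (gradAt ξ h) : MvPolynomial σ k →+* K) :=
    RingHom.ext fun f => aeval_aeval_pderiv ξ f h
  rw [← hcomp, ← aeval_X (R := k) ξ i]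
  exact Polynomial.hom_eval₂ _ _ _ _

variable {n : ℕ} {S X : Set (PSpace n)}

theorem exists_X_notMem_idealOf (hX : idealOf X ≠ ⊤) : ∃ i, MvPolynomial.X i ∉ idealOf X := by
  by_contra! h
  refine hX ((Ideal.eq_top_iff_one _).2 ?_)
  rintro v ⟨hv, hvX⟩
  refine absurd (funext fun i => ?_) hv
  have hi := h i v ⟨hv, hvX⟩
  rwa [aeval_X] at hi

variable {K : Type*} [Field K] [Algebra ℂ K] {ξ : Fin (n + 1) → K}

-- Conormal spaces do not change when `ξ` is rescaled, so that an algebraic equation for the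
-- coordinate `ξ i` over the coordinates of the conormal vectors holds coefficient by coefficient.
theorem coeff_mem_vanishingIdeal_conormal (hξ : idealOf S = vanishingIdeal ℂ {ξ}) {i : Fin (n + 1)}
    (hi : MvPolynomial.X i ∉ idealOf S) {p : Polynomial (MvPolynomial (Fin (n + 1)) ℂ)}
    (hp : ∀ a ∈ conormal (idealOf S) ξ,
      p.eval₂ (aeval (R := ℂ) a : MvPolynomial (Fin (n + 1)) ℂ →+* K) (ξ i) = 0) (m : ℕ) :
    p.coeff m ∈ vanishingIdeal ℂ (conormal (idealOf S) ξ : Set (Fin (n + 1) → K)) := by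
  have hI : (idealOf S).IsPrime := hξ ▸ inferInstance
  have hmem (h) (hh : h ∈ idealOf S) : p.eval₂ (aeval (R := ℂ) fun j => pderiv j h :
      MvPolynomial (Fin (n + 1)) ℂ →+* MvPolynomial (Fin (n + 1)) ℂ) (MvPolynomial.X i) ∈
        idealOf S := by
    rw [SetLike.ext_iff.1 hξ, mem_vanishingIdeal_singleton_iff, aeval_eval₂_pderiv]
    exact hp _ (Submodule.subset_span ⟨h, hh, rfl⟩)
  refine (mem_vanishingIdeal_conormal_iff hξ).2 fun h hh => ?_
  refine (hI.mem_or_mem (y := MvPolynomial.X i ^ m) fun v hv => ?_).resolve_right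
    (mt (hI.mem_of_pow_mem m) hi)
  have hzero : (p.map (aeval (R := ℂ) (gradAt v h) : MvPolynomial (Fin (n + 1)) ℂ →+* ℂ)).comp
      (Polynomial.C (v i) * Polynomial.X) = 0 := by
    refine polynomial_eq_zero_of_forall_eval_algebraMap_eq_zero ℂ fun t ht => ?_
    obtain ⟨g, hg, hgh⟩ := exists_gradAt_smul_eq hh ht
    have h0 := hmem g hg (t • v) (smul_mem_cone hv ht)
    rw [aeval_eval₂_pderiv, hgh] at h0
    rw [Polynomial.eval_comp, Polynomial.eval_map, Polynomial.eval_mul, Polynomial.eval_C,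
      Polynomial.eval_X, mul_comm]
    exact h0
  have hcoeff := congrArg (Polynomial.coeff · m) hzero
  rw [Polynomial.comp_C_mul_X_coeff, Polynomial.coeff_map] at hcoeff
  rw [map_mul, map_pow, aeval_X, aeval_aeval_pderiv]
  exact hcoeff

theorem vanishingIdeal_conormal_ne_bot (hξ : idealOf X = vanishingIdeal ℂ {ξ}) {d : ℕ}
    (hd : coneDim X = d) (hK : Algebra.trdeg ℂ K = d) :
    vanishingIdeal ℂ (conormal (idealOf X) ξ : Set (Fin (n + 1) → K)) ≠ ⊥ := by
  intro hbot
  have hI : (idealOf X).IsPrime := hξ ▸ inferInstance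
  have hperp := finrank_perp_conormal hξ hK hd
  have hle := Submodule.finrank_le (conormal (idealOf X) ξ)
  rw [finrank_perp] at hperp
  rw [finrank_fintype_fun_eq_card] at hle
  obtain ⟨i, hi⟩ := exists_X_notMem_idealOf hI.ne_top
  obtain ⟨p, hp0, hp⟩ := exists_polynomial_forall_mem_eval₂_eq_zero hbot hK (by lia) (ξ i)
  refine hp0 (Polynomial.ext fun m => ?_)
  have hm := coeff_mem_vanishingIdeal_conormal hξ hi hp m
  rwa [hbot] at hm

end ConormalNeBot

section Principal

/-! ### Linear spaces of codimension two -/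

/-- The linear form with coefficients `v`. -/
noncomputable def linearForm {R σ : Type*} [CommSemiring R] [Fintype σ] :
    (σ → R) →ₗ[R] MvPolynomial σ R :=
  Fintype.linearCombination R X

theorem aeval_linearForm {R A σ : Type*} [CommSemiring R] [CommSemiring A] [Algebra R A]
    [Fintype σ] (v : σ → R) (a : σ → A) : aeval a (linearForm v) = (algebraMap R A ∘ v) ⬝ᵥ a := by
  simp [linearForm, Fintype.linearCombination_apply, dotProduct, Algebra.smul_def]

theorem eval_linearForm {R σ : Type*} [CommSemiring R] [Fintype σ] (v w : σ → R) :
    eval w (linearForm v) = v ⬝ᵥ w :=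
  aeval_linearForm v w

theorem linearForm_ne_zero {R σ : Type*} [CommSemiring R] [Fintype σ] {v : σ → R} (hv : v ≠ 0) :
    linearForm v ≠ 0 := by
  classical
  contrapose! hv
  funext i
  simpa [hv] using (eval_linearForm v (Pi.single i 1)).symm

theorem toMvPolynomial_eq_linearForm {R m n : Type*} [CommSemiring R] [Fintype n]
    (M : Matrix m n R) (i : m) : M.toMvPolynomial i = linearForm (M i) := by
  simp [Matrix.toMvPolynomial, linearForm, Fintype.linearCombination_apply, X, smul_monomial]

theorem exists_basis_apply_eq_one {K V ι : Type*} [Field K] [AddCommGroup V] [Module K V]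
    [FiniteDimensional K V] {r : ℕ} (hr : finrank K V = r) (ℓ : ι → Dual K V)
    (hℓ : ∀ v, (∀ i, ℓ i v = 0) → v = 0) :
    ∃ (c : Fin r → ι) (e : Basis (Fin r) K V), ∀ i j, ℓ (c j) (e i) = (1 : Matrix _ _ K) i j := by
  obtain ⟨κ, c, -, hspan, hli⟩ := exists_linearIndependent' K ℓ
  have htop : ⊤ ≤ Submodule.span K (Set.range (ℓ ∘ c)) := by
    rw [hspan, Submodule.span_eq_top_of_ne_zero fun v hv => by
      by_contra! h
      exact hv (hℓ v fun i => h _ ⟨i, rfl⟩)]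
  let b := Basis.mk hli htop
  have : Finite κ := hli.finite
  have : Fintype κ := Fintype.ofFinite κ
  let u : κ ≃ Fin r := Fintype.equivFinOfCardEq <| by
    rw [← finrank_eq_card_basis b, Subspace.dual_finrank_eq, hr]
  let b' := b.reindex u
  refine ⟨c ∘ u.symm, b'.dualBasis.map (evalEquiv K V).symm, fun i j => ?_⟩
  have hb : ℓ (c (u.symm j)) = b' j := by simp [b', b]
  rw [Basis.map_apply, Function.comp_apply, hb, apply_evalEquiv_symm_apply,
    Basis.dualBasis_apply_self, Matrix.one_apply]
  simp only [eq_comm]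

theorem exists_reduced_basis {K σ ι : Type*} [Field K] [Finite σ] {N : Submodule K (σ → K)} {r : ℕ}
    (hr : finrank K N = r) (g : ι → σ) (hg : ∀ x ∈ N, x ∘ g = 0 → x = 0) :
    ∃ (c : Fin r → ι) (e : Fin r → σ → K),
      (∀ i j, e i (g (c j)) = (1 : Matrix _ _ K) i j) ∧ Submodule.span K (Set.range e) = N := by
  obtain ⟨c, e, he⟩ := exists_basis_apply_eq_one hr
    (fun i => (LinearMap.proj (g i)).comp N.subtype)
    fun v hv => Subtype.ext (hg v v.2 (_root_.funext hv))
  refine ⟨c, fun i => e i, he, ?_⟩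
  rw [Set.range_comp' Subtype.val e, ← Submodule.coe_subtype, Submodule.span_image, e.span_eq,
    Submodule.map_top, Submodule.range_subtype]

theorem ringKrullDim_quotient_add_one_le {R : Type*} [CommRing R] {P Q : Ideal R} [P.IsPrime]
    (h : P < Q) : ringKrullDim (R ⧸ Q) + 1 ≤ ringKrullDim (R ⧸ P) := by
  obtain ⟨g, hgQ, hgP⟩ := SetLike.exists_of_lt h
  exact ringKrullDim_succ_le_of_surjective (Ideal.Quotient.factor h.le)
    (Ideal.Quotient.factor_surjective h.le) (r := Ideal.Quotient.mk _ g)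
    (mem_nonZeroDivisors_of_ne_zero (mt Ideal.Quotient.eq_zero_iff_mem.1 hgP))
    (Ideal.Quotient.eq_zero_iff_mem.2 hgQ)

theorem ringKrullDim_quotient_add_two_le {k σ : Type*} [Field k] [Finite σ]
    {P : Ideal (MvPolynomial σ k)} {f : MvPolynomial σ k} (hf : Prime f) (hfP : f ∈ P)
    (hP : P ≠ Ideal.span {f}) : ringKrullDim (MvPolynomial σ k ⧸ P) + 1 + 1 ≤ Nat.card σ := by
  have : (Ideal.span {f}).IsPrime := (Ideal.span_singleton_prime hf.ne_zero).2 hf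
  have hdimP := ringKrullDim_quotient_add_one_le
    (lt_of_le_of_ne ((Ideal.span_singleton_le_iff_mem _).2 hfP) hP.symm)
  have hdimf := ringKrullDim_succ_le_of_surjective (Ideal.Quotient.mk (Ideal.span {f}))
    Ideal.Quotient.mk_surjective (mem_nonZeroDivisors_of_ne_zero hf.ne_zero)
    (Ideal.Quotient.eq_zero_iff_mem.2 (Ideal.mem_span_singleton_self f))
  rw [MvPolynomial.ringKrullDim_of_isNoetherianRing, ringKrullDim_eq_zero_of_field,
    zero_add] at hdimf
  exact (add_le_add_left hdimP 1).trans hdimf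

theorem eq_top_of_forall_eval_ne_zero_mem {k ι : Type*} [Field k] [Infinite k] [Finite ι]
    {f : MvPolynomial ι k} (hf : f ≠ 0) {W : Submodule k (ι → k)}
    (hW : ∀ z, eval z f ≠ 0 → z ∈ W) : W = ⊤ := by
  classical
  have := Fintype.ofFinite ι
  by_contra hne
  obtain ⟨φ, hφ, hφW⟩ := Submodule.exists_le_ker_of_lt_top W (lt_top_iff_ne_top.2 hne)
  obtain ⟨w, rfl⟩ := (dotProductEquiv k ι).surjective φ
  refine mul_ne_zero hf (linearForm_ne_zero ((LinearEquiv.map_ne_zero_iff _).1 hφ))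
    (MvPolynomial.funext fun z => ?_)
  rw [map_mul, eval_linearForm, map_zero, mul_eq_zero]
  exact or_iff_not_imp_left.2 fun hz => hφW (hW z hz)

theorem exists_polynomial_eval₂_linearForm_eq_zero {k K ι σ : Type*} [Field k] [Infinite k]
    [Field K] [Algebra k K] [Finite σ] [Fintype ι] [DecidableEq ι] {c : ι → σ} {e : ι → σ → K}
    (he : ∀ i j, e i (c j) = (1 : Matrix _ _ K) i j) {r : ℕ}
    (hr : ringKrullDim (MvPolynomial σ k ⧸
      vanishingIdeal k (Submodule.span K (Set.range e) : Set (σ → K))) = r)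
    (hι : r ≤ Fintype.card ι) (j : σ) :
    ∃ p : Polynomial (MvPolynomial ι k), p ≠ 0 ∧
      p.eval₂ (map (algebraMap k K)) (linearForm fun i => e i j) = 0 := by
  have : Infinite K := Infinite.of_injective _ (algebraMap k K).injective
  let P := vanishingIdeal k (Submodule.span K (Set.range e) : Set (σ → K))
  have : P.IsPrime := isPrime_vanishingIdeal_submodule _
  let A := MvPolynomial ι k
  let S := MvPolynomial σ k ⧸ P
  let ψ : A →ₐ[k] S := aeval fun i => Ideal.Quotient.mk _ (X (c i))
  let θ : S →ₐ[k] MvPolynomial ι K :=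
    Ideal.Quotient.liftₐ P (aeval (Matrix.of e).transpose.toMvPolynomial) fun _ hg =>
      (vanishingIdeal_span_range e).le hg
  have hθ (j) : θ (Ideal.Quotient.mk _ (X j)) = linearForm fun i => e i j :=
    (aeval_X _ _).trans (toMvPolynomial_eq_linearForm _ _)
  have hθψ : θ.comp ψ = mapAlgHom (Algebra.ofId k K) := by
    refine MvPolynomial.algHom_ext fun i => ?_
    rw [AlgHom.comp_apply, aeval_X, hθ]
    simp [he, linearForm, Fintype.linearCombination_apply, Matrix.one_apply]
  have hψ : Function.Injective ψ := by
    refine Function.Injective.of_comp (f := θ) ?_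
    rw [← AlgHom.coe_comp, hθψ]
    exact map_injective _ (algebraMap k K).injective
  let : Algebra A S := ψ.toAlgebra
  have : IsScalarTower k A S := .of_algebraMap_eq fun x => (ψ.commutes x).symm
  have : FaithfulSMul A S := (faithfulSMul_iff_algebraMap_injective _ _).2 hψ
  have hA : Algebra.trdeg k A = Fintype.card ι := by
    rw [MvPolynomial.trdeg_of_isDomain, Cardinal.mk_fintype, Cardinal.lift_natCast]
  have hS : Algebra.trdeg k S ≤ Fintype.card ι := by
    rw [trdeg_eq_of_ringKrullDim_eq (k := k) hr]
    exact_mod_cast hι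
  obtain ⟨p, hp0, hp⟩ := (isAlgebraic_of_trdeg_le hA hS).isAlgebraic (Ideal.Quotient.mk P (X j))
  refine ⟨p, hp0, ?_⟩
  have hcomp : (θ : S →+* MvPolynomial ι K).comp (algebraMap A S) =
      map (algebraMap k K) :=
    congrArg RingHomClass.toRingHom hθψ
  have hp' := congrArg θ hp
  rw [map_zero, Polynomial.aeval_def] at hp'
  rw [← hθ, ← hcomp, ← hp']
  exact (Polynomial.hom_eval₂ p _ (θ : S →+* MvPolynomial ι K) _).symm

variable {k K : Type*} [Field k] [IsAlgClosed k] [Field K] [Algebra k K]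

theorem mem_range_algebraMap_of_eval₂_linearForm_eq_zero {ι : Type*} [Fintype ι] {a : ι → K}
    {p : Polynomial (MvPolynomial ι k)} (hp0 : p ≠ 0)
    (hp : p.eval₂ (map (algebraMap k K)) (linearForm a) = 0) (i : ι) :
    a i ∈ (algebraMap k K).range := by
  classical
  let L : (ι → k) →ₗ[k] K := Fintype.linearCombination k a
  let W := (LinearMap.range (Algebra.linearMap k K)).comap L
  have hW : W = ⊤ := by
    refine eq_top_of_forall_eval_ne_zero_mem (Polynomial.leadingCoeff_ne_zero.2 hp0) fun z hz => ?_
    have halg : IsAlgebraic k (L z) := by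
      refine ⟨p.map (eval z), fun h0 => hz ?_, ?_⟩
      · rw [Polynomial.leadingCoeff, ← Polynomial.coeff_map, h0, Polynomial.coeff_zero]
      · have hcomp : (eval (algebraMap k K ∘ z)).comp (map (algebraMap k K)) =
            (algebraMap k K).comp (eval z) := RingHom.ext fun f => by
          rw [RingHom.comp_apply, eval_map, ← aeval_def, aeval_algebraMap_apply]
          rfl
        have hz := congrArg (eval (algebraMap k K ∘ z)) hp
        rw [Polynomial.hom_eval₂, hcomp, eval_linearForm, map_zero] at hz
        rw [Polynomial.aeval_def, Polynomial.eval₂_map, ← hz, dotProduct_comm]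
        congr 1
        simp only [L, Fintype.linearCombination_apply, dotProduct, Algebra.smul_def,
          Function.comp_apply]
    exact minpoly.mem_range_of_degree_eq_one k _
      (IsAlgClosed.degree_eq_one_of_irreducible k (minpoly.irreducible halg.isIntegral))
  have hi : Pi.single i 1 ∈ W := hW ▸ Submodule.mem_top
  rwa [Submodule.mem_comap, Fintype.linearCombination_apply_single, one_smul] at hi

theorem exists_eq_span_singleton_or_exists_basis {σ : Type*} [Fintype σ]
    {N : Submodule K (σ → K)} (hN : finrank K N + 2 = Fintype.card σ)
    (hbot : vanishingIdeal k (N : Set (σ → K)) ≠ ⊥) :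
    (∃ f, f ≠ 0 ∧ vanishingIdeal k (N : Set (σ → K)) = Ideal.span {f}) ∨
    ∃ v : Fin (finrank K N) → σ → k, LinearIndependent k v ∧ ∀ i, algebraMap k K ∘ v i ∈ N := by
  have : Infinite K := Infinite.of_injective _ (algebraMap k K).injective
  obtain ⟨c, e, he, hspan⟩ := exists_reduced_basis (N := N) rfl id fun _ _ h => h
  have hP : (vanishingIdeal k (N : Set (σ → K))).IsPrime := isPrime_vanishingIdeal_submodule _
  obtain ⟨f, hfP, hf⟩ := hP.exists_mem_prime_of_ne_bot hbot
  refine or_iff_not_imp_left.2 fun hne => ?_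
  have hdim := ringKrullDim_quotient_add_two_le hf hfP fun h => hne ⟨f, hf.ne_zero, h⟩
  obtain ⟨r, hr, -⟩ := exists_ringKrullDim_eq_and_trdeg_eq (k := k)
    (R := MvPolynomial σ k ⧸ vanishingIdeal k (N : Set (σ → K)))
  have hrN : r ≤ Fintype.card (Fin (finrank K N)) := by
    rw [hr, Nat.card_eq_fintype_card, ← hN] at hdim
    rw [Fintype.card_fin]
    have hdim' : r + 1 + 1 ≤ finrank K N + 2 := by exact_mod_cast hdim
    lia
  have hmem (i j) : e i j ∈ (algebraMap k K).range := by
    obtain ⟨p, hp0, hp⟩ := exists_polynomial_eval₂_linearForm_eq_zero (k := k) he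
      (hspan.symm ▸ hr) hrN j
    exact mem_range_algebraMap_of_eval₂_linearForm_eq_zero hp0 hp i
  choose v hv using hmem
  refine ⟨v, linearIndependent_of_det_ne_zero c ?_, fun i => ?_⟩
  · have hone : (Matrix.of fun i j => v i (c j)) = 1 := Matrix.ext fun i j => by
      refine (algebraMap k K).injective ?_
      rw [Matrix.of_apply, hv, show e i (c j) = _ from he i j, Matrix.one_apply, Matrix.one_apply,
        apply_ite (algebraMap k K), map_one, map_zero]
    rw [hone, Matrix.det_one]
    exact one_ne_zero
  · rw [show algebraMap k K ∘ v i = e i from _root_.funext (hv i), ← hspan]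
    exact Submodule.subset_span ⟨i, rfl⟩

end Principal

section Lines

/-! ### The ideal of the dual variety of a curve -/

theorem ringKrullDim_quotient_vanishingIdeal_le {k σ : Type*} [Field k] [Infinite k] [Finite σ]
    (N : Submodule k (σ → k)) :
    ringKrullDim (MvPolynomial σ k ⧸ vanishingIdeal k (N : Set (σ → k))) ≤ finrank k N := by
  obtain ⟨v, hv⟩ := exists_span_range_eq N
  rw [← hv, vanishingIdeal_span_range, hv]
  let φ := aeval (R := k) (Matrix.of v).transpose.toMvPolynomial
  have : (RingHom.ker φ).IsPrime := RingHom.ker_isPrime φ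
  obtain ⟨s, hs, htr⟩ := exists_ringKrullDim_eq_and_trdeg_eq (k := k)
    (R := MvPolynomial σ k ⧸ RingHom.ker φ)
  have hle := lift_trdeg_le_of_injective _ (Ideal.kerLiftAlg_injective φ)
  rw [htr, MvPolynomial.trdeg_of_isDomain] at hle
  rw [hs]
  simp only [Cardinal.lift_natCast, Cardinal.mk_fin, Nat.cast_le] at hle
  exact_mod_cast hle

variable {n : ℕ} {S X : Set (PSpace n)}

theorem eq_setOf_submodule_le (hX : zariskiClosure X = X) {L : Submodule ℂ (Fin (n + 1) → ℂ)}
    (hXL : cone X ⊆ L) (hdim : coneDim X = finrank ℂ L) : X = {p | p.submodule ≤ L} := by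
  have : (vanishingIdeal ℂ (L : Set (Fin (n + 1) → ℂ))).IsPrime :=
    isPrime_vanishingIdeal_submodule L
  have hle : vanishingIdeal ℂ (L : Set (Fin (n + 1) → ℂ)) ≤ idealOf X :=
    vanishingIdeal_anti_mono hXL
  have hideal : vanishingIdeal ℂ (L : Set (Fin (n + 1) → ℂ)) = idealOf X := by
    by_contra hne
    have hlt := (ringKrullDim_quotient_add_one_le (lt_of_le_of_ne hle hne)).trans
      (ringKrullDim_quotient_vanishingIdeal_le L)
    rw [← coneDim, hdim] at hlt
    have hlt' : finrank ℂ L + 1 ≤ finrank ℂ L := by exact_mod_cast hlt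
    lia
  ext p
  rw [Set.mem_ofPred_eq, Projectivization.submodule_eq, Submodule.span_singleton_le_iff_mem]
  refine ⟨fun hp => hXL (rep_mem_cone.2 hp), fun hp => ?_⟩
  rw [← hX]
  exact fun f hf => (hideal ▸ hf : f ∈ vanishingIdeal ℂ (L : Set (Fin (n + 1) → ℂ))) _ hp

theorem isLine_of_linearForm_mem (hX : zariskiClosure X = X) (hdim : coneDim X = 2) {r : ℕ}
    (hr : r + 1 = n) {v : Fin r → Fin (n + 1) → ℂ} (hv : LinearIndependent ℂ v)
    (hvX : ∀ i, linearForm (v i) ∈ idealOf X) : IsLine X := by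
  let L := perp (Submodule.span ℂ (Set.range v))
  have hL : finrank ℂ L = 2 := by
    rw [finrank_perp, finrank_span_eq_card hv, Fintype.card_fin, Fintype.card_fin]
    lia
  refine ⟨L, hL, eq_setOf_submodule_le hX (fun w hw => ?_) (by rw [hdim, hL]; rfl)⟩
  rw [SetLike.mem_coe, mem_perp_span, Set.forall_mem_range]
  intro i
  rw [← eval_linearForm]
  exact hvX i w hw

theorem dotProduct_eq_zero_of_mem_conormal {k K σ : Type*} [Field k] [Field K] [Algebra k K]
    [Fintype σ] {I : Ideal (MvPolynomial σ k)} (hI : ∀ f ∈ I, ∀ d, homogeneousComponent d f ∈ I)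
    {ξ : σ → K} (hξ : I ≤ vanishingIdeal k {ξ}) {a : σ → K} (ha : a ∈ conormal I ξ) :
    a ⬝ᵥ ξ = 0 := by
  have hmem : ξ ∈ perp (conormal I ξ) := by
    rw [conormal, mem_perp_span, Set.forall_mem_image]
    intro f hf
    have hEuler : ∑ i, X i * pderiv i f ∈ I := by
      rw [← sum_homogeneousComponent f]
      simp only [map_sum, Finset.mul_sum]
      rw [Finset.sum_comm]
      refine Ideal.sum_mem _ fun d _ => ?_
      rw [(homogeneousComponent_isHomogeneous d f).sum_X_mul_pderiv]
      exact nsmul_mem (hI f hf d) d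
    have hsum := hξ hEuler
    rw [mem_vanishingIdeal_singleton_iff, map_sum] at hsum
    rw [dotProduct_comm, ← hsum]
    simp [dotProduct, gradAt_apply]
  exact hmem a ha

theorem exists_idealOf_dualVariety_eq_span_singleton (hX : IsIrreducibleCurve X) (hn : 2 ≤ n)
    (hline : ¬ IsLine X) : ∃ f, f ≠ 0 ∧ idealOf (dualVariety X) = Ideal.span {f} := by
  have := hX.irreducible
  have hξ : idealOf X = vanishingIdeal ℂ {genericPoint (idealOf X)} :=
    (vanishingIdeal_genericPoint _).symm
  have hK := trdeg_functionField (idealOf X) hX.dim_eq_one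
  have hN := finrank_perp_conormal hξ hK hX.dim_eq_one
  rw [finrank_perp, Fintype.card_fin] at hN
  rw [idealOf_dualVariety hX.dim_eq_one hn hξ]
  refine (exists_eq_span_singleton_or_exists_basis (by rw [Fintype.card_fin]; lia)
    (vanishingIdeal_conormal_ne_bot hξ hX.dim_eq_one hK)).resolve_right ?_
  rintro ⟨v, hv, hvN⟩
  refine hline (isLine_of_linearForm_mem hX.closed hX.dim_eq_one (by lia) hv fun i => ?_)
  rw [SetLike.ext_iff.1 hξ, mem_vanishingIdeal_singleton_iff, aeval_linearForm]
  exact dotProduct_eq_zero_of_mem_conormal (fun _ => homogeneousComponent_mem_idealOf) hξ.le (hvN i)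

/-! ### Minimal equations -/

theorem isMinimalEquation_of_idealOf_eq_span_singleton (hS : zariskiClosure S = S)
    {f : MvPolynomial (Fin (n + 1)) ℂ} (hf : f ≠ 0) (h : idealOf S = Ideal.span {f}) :
    IsMinimalEquation f S := by
  have hfS : f ∈ idealOf S := h ▸ Ideal.mem_span_singleton_self f
  have hhom : f.IsHomogeneous f.totalDegree :=
    isHomogeneous_of_homogeneousComponent_mem_span_singleton fun d =>
      h ▸ homogeneousComponent_mem_idealOf hfS d
  refine ⟨⟨hf, hhom, Set.ext fun p => ⟨fun hp => hfS _ (rep_mem_cone.2 hp), fun hp => ?_⟩⟩, ?_⟩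
  · rw [← hS]
    intro g hg
    rw [h, Ideal.mem_span_singleton] at hg
    obtain ⟨g, rfl⟩ := hg
    rw [map_mul]
    exact mul_eq_zero_of_left hp _
  · rintro G ⟨hG0, hG, hGS⟩
    refine totalDegree_le_of_dvd_of_isDomain ?_ hG0
    rw [← Ideal.mem_span_singleton, ← h]
    rintro v ⟨hv, hvS⟩
    obtain ⟨c, hc⟩ := Projectivization.exists_smul_eq_mk_rep ℂ v hv
    rw [hGS, Set.mem_ofPred_eq, ← hc, ← aeval_eq_eval] at hvS
    have hGc := aeval_smul_of_isHomogeneous (A := ℂ) hG v (c : ℂ)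
    exact (mul_eq_zero.1 (hGc.symm.trans hvS)).resolve_left (pow_ne_zero _ c.ne_zero)

theorem zariskiClosure_dualVariety (X : Set (PSpace n)) :
    zariskiClosure (dualVariety X) = dualVariety X := by
  conv_lhs => rw [zariskiClosure, dualVariety, idealOf_zariskiClosure]
  rfl

theorem IsMinimalEquation.totalDegree_eq {F G : MvPolynomial (Fin (n + 1)) ℂ}
    (hF : IsMinimalEquation F S) (hG : IsMinimalEquation G S) : F.totalDegree = G.totalDegree :=
  le_antisymm (hF.2 G hG.1) (hG.2 F hF.1)

end Lines

section LeadingCoefficient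

/-! ### Restriction to lines -/

theorem coeff_prod_sum_of_natDegree_le {R ι : Type*} [CommSemiring R] (s : Finset ι)
    {p : ι → Polynomial R} {m : ι → ℕ} (h : ∀ i ∈ s, (p i).natDegree ≤ m i) :
    (∏ i ∈ s, p i).coeff (∑ i ∈ s, m i) = ∏ i ∈ s, (p i).coeff (m i) := by
  classical
  induction s using Finset.induction_on with
  | empty => simp
  | insert i s hi ih =>
    rw [Finset.forall_mem_insert] at h
    rw [Finset.prod_insert hi, Finset.sum_insert hi, Finset.prod_insert hi, ← ih h.2]
    exact Polynomial.coeff_mul_add_eq_of_natDegree_le h.1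
      ((Polynomial.natDegree_prod_le s p).trans (Finset.sum_le_sum h.2))

theorem coeff_aeval_of_isHomogeneous {k A σ : Type*} [CommSemiring k] [CommSemiring A] [Algebra k A]
    {f : MvPolynomial σ k} {d : ℕ} (hf : f.IsHomogeneous d) {p : σ → Polynomial A}
    (hp : ∀ i, (p i).natDegree ≤ 1) :
    (aeval p f).coeff d = aeval (fun i => (p i).coeff 1) f := by
  rw [aeval_def, aeval_def, eval₂_eq, eval₂_eq, Polynomial.finsetSum_coeff]
  refine Finset.sum_congr rfl fun m hm => ?_
  have hd : ∑ i ∈ m.support, m i = d := hf.degree_eq_sum_deg_support hm |>.symm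
  rw [Polynomial.algebraMap_apply, Polynomial.coeff_C_mul, ← hd, coeff_prod_sum_of_natDegree_le]
  · refine congrArg _ (Finset.prod_congr rfl fun i _ => ?_)
    simpa using Polynomial.coeff_pow_of_natDegree_le (hp i) (m := m i)
  · exact fun i _ => (Polynomial.natDegree_pow_le_of_le _ (hp i)).trans (mul_one _).le

end LeadingCoefficient

section Integrality

/-! ### Projections and integral extensions -/

theorem ringKrullDim_quotient_comap_eq {R S : Type*} [CommRing R] [CommRing S] {φ : R →+* S}
    {I : Ideal S} (h : ((Ideal.Quotient.mk I).comp φ).IsIntegral) :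
    ringKrullDim (R ⧸ I.comap φ) = ringKrullDim (S ⧸ I) := by
  let : Algebra (R ⧸ I.comap φ) (S ⧸ I) := (Ideal.quotientMap I φ le_rfl).toAlgebra
  have : Algebra.IsIntegral (R ⧸ I.comap φ) (S ⧸ I) :=
    ⟨RingHom.IsIntegral.tower_top (Ideal.Quotient.mk _) _ h⟩
  exact ringKrullDim_eq_of_injective_of_isIntegral Ideal.quotientMap_injective

variable {k m n : Type*} [CommRing k] [Fintype m] [Fintype n] [DecidableEq n]
  {I : Ideal (MvPolynomial n k)} {M : Matrix m n k} {B : Matrix n m k} {o l : n → k}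

theorem X_eq_pullback_add (h : B * M + Matrix.vecMulVec o l = 1) (i : n) :
    X i = pullback M (B.toMvPolynomial i) + C (o i) * linearForm l := by
  rw [pullback, ← Matrix.toMvPolynomial_mul, ← algebraMap_eq, ← Algebra.smul_def, ← map_smul,
    ← congrFun (Matrix.toMvPolynomial_one (R := k)) i, ← h, Matrix.toMvPolynomial_add,
    Pi.add_apply, toMvPolynomial_eq_linearForm (Matrix.vecMulVec o l)]
  rfl

theorem isIntegralElem_mk_linearForm (h : B * M + Matrix.vecMulVec o l = 1)
    {f : MvPolynomial n k} {d : ℕ} (hf : f ∈ I) (hd : f.IsHomogeneous d)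
    (ho : IsUnit (eval o f)) :
    ((Ideal.Quotient.mk I).comp (pullback M : MvPolynomial m k →+* _)).IsIntegralElem
      (Ideal.Quotient.mk I (linearForm l)) := by
  let φ := (Ideal.Quotient.mkₐ k I).comp (pullback M)
  let b (i : n) : Polynomial (MvPolynomial m k) :=
    Polynomial.C (B.toMvPolynomial i) + Polynomial.C (C (o i)) * Polynomial.X
  have hb (i : n) : (b i).natDegree ≤ 1 := by
    dsimp only [b]
    compute_degree
  have hcoeff : (aeval b f).coeff d = C (eval o f) := by
    rw [coeff_aeval_of_isHomogeneous hd hb, ← aeval_eq_eval]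
    simpa [b] using! aeval_algebraMap_apply (MvPolynomial m k) o f
  have hroot : (aeval b f).eval₂ φ.toRingHom (Ideal.Quotient.mk I (linearForm l)) = 0 := by
    let ψ := Polynomial.eval₂AlgHom φ (Ideal.Quotient.mk I (linearForm l)) fun _ => .all _ _
    have hψ : ψ.comp (aeval b) = Ideal.Quotient.mkₐ k I := by
      ext i
      have hi := congrArg (Ideal.Quotient.mkₐ k I) (X_eq_pullback_add h i)
      simpa [ψ, b, φ] using! hi.symm
    exact (DFunLike.congr_fun hψ f).trans (Ideal.Quotient.eq_zero_iff_mem.2 hf)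
  refine ⟨Polynomial.C (C (↑ho.unit⁻¹ : k)) * aeval b f, ?_, ?_⟩
  · refine Polynomial.monic_of_natDegree_le_of_coeff_eq_one d
      ((Polynomial.natDegree_C_mul_le _ _).trans ?_) ?_
    · rw [← aeval_map_algebraMap (MvPolynomial m k), ← mul_one d]
      exact aeval_natDegree_le _ ((hd.map _).totalDegree_le) b hb
    · rw [Polynomial.coeff_C_mul, hcoeff, ← C_mul, ho.val_inv_mul, C_1]
  · rw [Polynomial.eval₂_mul]
    exact mul_eq_zero_of_right _ hroot

theorem isIntegral_mk_comp_pullback (h : B * M + Matrix.vecMulVec o l = 1)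
    {f : MvPolynomial n k} {d : ℕ} (hf : f ∈ I) (hd : f.IsHomogeneous d)
    (ho : IsUnit (eval o f)) :
    ((Ideal.Quotient.mk I).comp (pullback M : MvPolynomial m k →+* _)).IsIntegral := by
  set φ := (Ideal.Quotient.mk I).comp (pullback M : MvPolynomial m k →+* _)
  have hC (a : k) : φ.IsIntegralElem (Ideal.Quotient.mk I (C a)) := by
    have hφ : φ (C a) = Ideal.Quotient.mk I (C a) :=
      congrArg (Ideal.Quotient.mk I) ((pullback M).commutes a)
    exact hφ ▸ φ.isIntegralElem_map
  intro x
  obtain ⟨g, rfl⟩ := Ideal.Quotient.mk_surjective x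
  induction g using MvPolynomial.induction_on with
  | C a => exact hC a
  | add g h hg hh => exact map_add (Ideal.Quotient.mk I) g h ▸ hg.add _ hh
  | mul_X g i hg =>
    rw [map_mul, X_eq_pullback_add h i, map_add, map_mul]
    exact hg.mul _ (φ.isIntegralElem_map.add _
      ((hC _).mul _ (isIntegralElem_mk_linearForm h hf hd ho)))

theorem exists_mulVec_eq_of_isIntegral {k m n : Type*} [Field k] [IsAlgClosed k] [Fintype n]
    {I : Ideal (MvPolynomial n k)} {M : Matrix m n k}
    (h : ((Ideal.Quotient.mk I).comp (pullback M : MvPolynomial m k →+* _)).IsIntegral)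
    {w : m → k} (hw : ∀ g, pullback M g ∈ I → eval w g = 0) :
    ∃ v, (∀ f ∈ I, eval v f = 0) ∧ M.mulVec v = w := by
  let φ := (Ideal.Quotient.mk I).comp (pullback M : MvPolynomial m k →+* _)
  let : Algebra (MvPolynomial m k) (MvPolynomial n k ⧸ I) := φ.toAlgebra
  have : Algebra.IsIntegral (MvPolynomial m k) (MvPolynomial n k ⧸ I) := ⟨h⟩
  obtain ⟨Q, hQ, hQw⟩ := Ideal.exists_ideal_over_maximal_of_isIntegral
    (S := MvPolynomial n k ⧸ I) (vanishingIdeal k {w}) (by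
      rintro g hg _ rfl
      exact hw g (Ideal.Quotient.eq_zero_iff_mem.1 hg))
  obtain ⟨v, hv⟩ := isMaximal_iff_eq_vanishingIdeal_singleton.1
    (Ideal.comap_isMaximal_of_surjective _ Ideal.Quotient.mk_surjective :
      (Q.comap (Ideal.Quotient.mk I)).IsMaximal)
  have heval {f : MvPolynomial n k} (hf : Ideal.Quotient.mk I f ∈ Q) : eval v f = 0 :=
    (hv ▸ hf : f ∈ vanishingIdeal k {v}) v rfl
  refine ⟨v, fun f hf => heval ?_, funext fun i => ?_⟩
  · rw [Ideal.Quotient.eq_zero_iff_mem.2 hf]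
    exact Q.zero_mem
  · have hi : X i - C (w i) ∈ vanishingIdeal k {w} := by
      rintro _ rfl
      simp
    rw [← hQw] at hi
    have hvi := heval (show Ideal.Quotient.mk I (pullback M (X i - C (w i))) ∈ Q from hi)
    rwa [eval_pullback, map_sub, eval_X, eval_C, sub_eq_zero] at hvi

end Integrality

section Projection

/-! ### Projections from a point -/

theorem vanishingIdeal_comap_pullback {k K m n : Type*} [Field k] [Field K] [Algebra k K]
    [Fintype n] {I : Ideal (MvPolynomial n k)} {ξ : n → K} (hξ : I = vanishingIdeal k {ξ})
    (M : Matrix m n k) :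
    I.comap (pullback M) = vanishingIdeal k {(M.map (algebraMap k K)).mulVec ξ} := by
  ext g
  rw [Ideal.mem_comap, hξ, mem_vanishingIdeal_singleton_iff, mem_vanishingIdeal_singleton_iff,
    aeval_pullback]

theorem conormal_comap_pullback {k K m n : Type*} [Field k] [CharZero k] [Field K] [Algebra k K]
    [Fintype m] [Fintype n] {I : Ideal (MvPolynomial n k)} {ξ : n → K}
    (hξ : I = vanishingIdeal k {ξ}) {M : Matrix m n k} {d : ℕ} (hK : Algebra.trdeg k K = d)
    (hI : ringKrullDim (MvPolynomial n k ⧸ I) = d)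
    (hM : ringKrullDim (MvPolynomial m k ⧸ I.comap (pullback M)) = d)
    (hker : Disjoint (perp (conormal I ξ))
      (LinearMap.ker (M.map (algebraMap k K)).mulVecLin)) :
    conormal (I.comap (pullback M)) ((M.map (algebraMap k K)).mulVec ξ) =
      (conormal I ξ).comap (M.map (algebraMap k K)).transpose.mulVecLin := by
  set MK := M.map (algebraMap k K)
  set N := conormal I ξ
  set N' := conormal (I.comap (pullback M)) (MK.mulVec ξ)
  have hdot (b : m → K) (w : n → K) : MK.transpose.mulVec b ⬝ᵥ w = b ⬝ᵥ MK.mulVec w := by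
    rw [Matrix.mulVec_transpose, Matrix.dotProduct_mulVec]
  have hle : N' ≤ N.comap MK.transpose.mulVecLin := by
    refine Submodule.span_le.2 ?_
    rintro _ ⟨g, hg, rfl⟩
    exact Submodule.subset_span ⟨pullback M g, hg, gradAt_pullback M g ξ⟩
  have hmap : (perp N).map MK.mulVecLin = perp N' := by
    refine Submodule.eq_of_le_of_finrank_le ?_ ?_
    · rintro _ ⟨w, hw, rfl⟩ b hb
      exact (hdot b w).symm.trans (hw _ (hle hb))
    · have hinj : Function.Injective (MK.mulVecLin.domRestrict (perp N)) :=
        LinearMap.injective_domRestrict_iff.2 hker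
      rw [← LinearMap.range_domRestrict, LinearMap.finrank_range_of_inj hinj,
        finrank_perp_conormal hξ hK hI,
        finrank_perp_conormal (vanishingIdeal_comap_pullback hξ M) hK hM]
  refine le_antisymm hle fun b hb => ?_
  rw [← perp_perp N', ← hmap]
  rintro _ ⟨w, hw, rfl⟩
  exact (dotProduct_comm _ b).trans ((hdot b w).symm.trans (hw _ hb))

theorem exists_mul_eq_one_and_mul_add_vecMulVec_eq_one {k m n : Type*} [Field k] [Fintype m]
    [Fintype n] [DecidableEq m] [DecidableEq n] {M : Matrix m n k} {o : n → k}
    (hM : Function.Surjective M.mulVec) (ho : LinearMap.ker M.mulVecLin = Submodule.span k {o}) :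
    ∃ (B : Matrix n m k) (l : n → k), M * B = 1 ∧ B * M + Matrix.vecMulVec o l = 1 := by
  obtain ⟨B, hB⟩ := Matrix.mulVec_surjective_iff_exists_right_inverse.1 hM
  have hl (j : n) : ∃ c : k, c • o = (1 - B * M).col j := by
    rw [← Submodule.mem_span_singleton, ← ho, LinearMap.mem_ker, Matrix.mulVecLin_apply,
      ← Matrix.mulVec_single_one, Matrix.mulVec_mulVec, Matrix.mul_sub, ← Matrix.mul_assoc, hB,
      Matrix.one_mul, Matrix.mul_one, sub_self, Matrix.zero_mulVec]
  choose l hl using hl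
  refine ⟨B, l, hB, add_eq_of_eq_sub' ?_⟩
  ext i j
  rw [Matrix.vecMulVec_apply, mul_comm]
  exact congrFun (hl j) i

theorem map_mul_map_add_vecMulVec_eq_one {R S m n : Type*} [CommSemiring R] [CommSemiring S]
    [Fintype m] [DecidableEq n] (f : R →+* S) {M : Matrix m n R} {B : Matrix n m R} {o l : n → R}
    (h : B * M + Matrix.vecMulVec o l = 1) :
    B.map f * M.map f + Matrix.vecMulVec (f ∘ o) (f ∘ l) = 1 := by
  have hol : Matrix.vecMulVec (f ∘ o) (f ∘ l) = (Matrix.vecMulVec o l).map f :=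
    Matrix.ext fun i j => (map_mul f (o i) (l j)).symm
  rw [hol, ← Matrix.map_mul, ← Matrix.map_add _ (map_add f), h,
    Matrix.map_one _ (map_zero f) (map_one f)]

section Splitting

variable {F m n : Type*} [Field F] [Fintype m] [Fintype n] [DecidableEq n] {M : Matrix m n F}
  {B : Matrix n m F} {o l : n → F}

theorem transpose_mulVec_transpose_mulVec (h : B * M + Matrix.vecMulVec o l = 1) {a : n → F}
    (ha : a ⬝ᵥ o = 0) : M.transpose.mulVec (B.transpose.mulVec a) = a := by
  rw [Matrix.mulVec_transpose, Matrix.mulVec_transpose, Matrix.vecMul_vecMul]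
  simpa [Matrix.vecMul_add, Matrix.vecMul_vecMulVec, ha] using congrArg (Matrix.vecMul a) h

theorem disjoint_perp_ker_mulVecLin (h : B * M + Matrix.vecMulVec o l = 1)
    {N : Submodule F (n → F)} (hN : ∃ a ∈ N, a ⬝ᵥ o ≠ 0) :
    Disjoint (perp N) (LinearMap.ker M.mulVecLin) := by
  obtain ⟨a, ha, hao⟩ := hN
  rw [Submodule.disjoint_def]
  intro w hw hMw
  replace hMw : M.mulVec w = 0 := hMw
  have hwo : (l ⬝ᵥ w) • o = w := by
    simpa [Matrix.add_mulVec, ← Matrix.mulVec_mulVec, hMw, Matrix.vecMulVec_mulVec] using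
      congrArg (fun A => A.mulVec w) h
  have haw : (l ⬝ᵥ w) * (a ⬝ᵥ o) = 0 := by
    rw [← smul_eq_mul, ← dotProduct_smul, hwo]
    exact hw a ha
  rw [← hwo, (mul_eq_zero.1 haw).resolve_right hao, zero_smul]

end Splitting

variable {X : Set (PSpace 3)} {M : Matrix (Fin 3) (Fin 4) ℂ} {o : Fin 4 → ℂ}

theorem surjective_mulVec_of_ker_eq_span (hM : LinearMap.ker M.mulVecLin = Submodule.span ℂ {o}) :
    Function.Surjective M.mulVec := by
  have hrank := LinearMap.finrank_range_add_finrank_ker M.mulVecLin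
  have hle : finrank ℂ (LinearMap.ker M.mulVecLin) ≤ 1 := by
    rw [hM]
    exact (finrank_span_le_card _).trans (by simp)
  have htop : LinearMap.range M.mulVecLin = ⊤ := by
    refine Submodule.eq_top_of_finrank_eq (le_antisymm (Submodule.finrank_le _) ?_)
    rw [finrank_fin_fun] at hrank ⊢
    lia
  exact LinearMap.range_eq_top.1 htop

theorem mulVec_ne_zero_of_mem_cone (hM : LinearMap.ker M.mulVecLin = Submodule.span ℂ {o})
    (ho : o ∉ cone X) {v : Fin 4 → ℂ} (hv : v ∈ cone X) : M.mulVec v ≠ 0 := by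
  intro h
  obtain ⟨c, rfl⟩ := Submodule.mem_span_singleton.1 (hM ▸ h : v ∈ Submodule.span ℂ {o})
  have hc : c ≠ 0 := left_ne_zero_of_smul hv.1
  exact ho (inv_smul_smul₀ hc o ▸ smul_mem_cone hv (inv_ne_zero hc))

theorem mem_cone_projection (hM : LinearMap.ker M.mulVecLin = Submodule.span ℂ {o})
    (ho : o ∉ cone X) {w : Fin 3 → ℂ} :
    w ∈ cone (projection M X) ↔ ∃ v ∈ cone X, M.mulVec v = w := by
  constructor
  · rintro ⟨hw, p, hp, h, hpw⟩
    obtain ⟨c, rfl⟩ := (Projectivization.mk_eq_mk_iff' ℂ _ _ hw h).1 hpw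
    exact ⟨c • p.rep, smul_mem_cone (rep_mem_cone.2 hp) (left_ne_zero_of_smul hw),
      Matrix.mulVec_smul _ _ _⟩
  · rintro ⟨v, hv, rfl⟩
    have hMv := mulVec_ne_zero_of_mem_cone hM ho hv
    obtain ⟨hv0, hvX⟩ := hv
    obtain ⟨c, hc⟩ := Projectivization.exists_smul_eq_mk_rep ℂ v hv0
    refine ⟨hMv, _, hvX, mulVec_ne_zero_of_mem_cone hM ho (rep_mem_cone.2 hvX), ?_⟩
    rw [Projectivization.mk_eq_mk_iff]
    exact ⟨c⁻¹, by rw [← hc, Matrix.mulVec_smul, inv_smul_smul]⟩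

theorem idealOf_projection (hM : LinearMap.ker M.mulVecLin = Submodule.span ℂ {o})
    (ho : o ∉ cone X) : idealOf (projection M X) = (idealOf X).comap (pullback M) := by
  ext g
  simp only [idealOf, Ideal.mem_comap, mem_vanishingIdeal_iff, mem_cone_projection hM ho,
    forall_exists_index, and_imp, forall_apply_eq_imp_iff₂, aeval_eq_eval,
    eval_pullback]

theorem isIrreducibleCurve_projection (hX : IsIrreducibleCurve X)
    (hM : LinearMap.ker M.mulVecLin = Submodule.span ℂ {o}) (ho0 : o ≠ 0) (ho : o ∉ cone X) :
    IsIrreducibleCurve (projection M X) := by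
  have := hX.irreducible
  have hideal := idealOf_projection hM ho
  obtain ⟨B, l, -, h⟩ :=
    exists_mul_eq_one_and_mul_add_vecMulVec_eq_one (surjective_mulVec_of_ker_eq_span hM) hM
  obtain ⟨f, hf, d, hfo⟩ : ∃ f ∈ idealOf X, ∃ d, eval o (homogeneousComponent d f) ≠ 0 := by
    rw [mem_cone_iff_of_closed hX.closed ho0] at ho
    contrapose! ho
    intro f hf
    rw [← sum_homogeneousComponent f, map_sum]
    exact Finset.sum_eq_zero fun d _ => ho f hf d
  have hint := isIntegral_mk_comp_pullback h (homogeneousComponent_mem_idealOf hf d)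
    (homogeneousComponent_isHomogeneous d f) hfo.isUnit
  refine ⟨(subset_zariskiClosure _).antisymm' fun q hq => ?_, ?_, ?_⟩
  · rw [zariskiClosure, hideal] at hq
    obtain ⟨v, hv, hvq⟩ := exists_mulVec_eq_of_isIntegral hint hq
    have hv0 : v ≠ 0 := by
      rintro rfl
      exact q.rep_nonzero (hvq.symm.trans (Matrix.mulVec_zero _))
    rw [← rep_mem_cone, mem_cone_projection hM ho]
    exact ⟨v, (mem_cone_iff_of_closed hX.closed hv0).2 hv, hvq⟩
  · rw [hideal]
    exact Ideal.comap_isPrime _ _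
  · rw [coneDim, hideal]
    exact (ringKrullDim_quotient_comap_eq hint).trans hX.dim_eq_one

theorem not_isLine_projection (hM : LinearMap.ker M.mulVecLin = Submodule.span ℂ {o})
    (ho : o ∉ cone X) (hlin : ∀ w ≠ 0, linearForm w ∈ idealOf X → w ⬝ᵥ o ≠ 0) :
    ¬ IsLine (projection M X) := by
  rintro ⟨L, hL, hXL⟩
  have hperp : perp L ≠ ⊥ := by
    rw [← Submodule.one_le_finrank_iff, finrank_perp, hL, Fintype.card_fin]
  obtain ⟨w, hw, hw0⟩ := Submodule.exists_mem_ne_zero_of_ne_bot hperp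
  have hdot (v : Fin 4 → ℂ) : M.transpose.mulVec w ⬝ᵥ v = w ⬝ᵥ M.mulVec v := by
    rw [Matrix.mulVec_transpose, Matrix.dotProduct_mulVec]
  refine hlin (M.transpose.mulVec w) (fun h => hw0 (dotProduct_eq_zero_iff.1 fun u => ?_))
    (fun v hv => ?_) ?_
  · obtain ⟨v, rfl⟩ := surjective_mulVec_of_ker_eq_span hM u
    rw [← hdot, h, zero_dotProduct]
  · obtain ⟨hMv, hv⟩ := (mem_cone_projection hM ho).2 ⟨v, hv, rfl⟩
    rw [hXL, Set.mem_ofPred_eq, Projectivization.submodule_mk,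
      Submodule.span_singleton_le_iff_mem] at hv
    rw [aeval_eq_eval, eval_linearForm, hdot, dotProduct_comm]
    exact hw _ hv
  · have hMo : M.mulVec o = 0 := by
      have : o ∈ LinearMap.ker M.mulVecLin := hM ▸ Submodule.mem_span_singleton_self o
      exact this
    rw [hdot, hMo, dotProduct_zero]

end Projection

section GenericIndependence

/-! ### Generic linear independence -/

variable {k K σ τ ι : Type*} [Field k] [Field K] [Algebra k K]

theorem exists_forall_eval_eq (ψ : K →ₗ[k] k) (E : MvPolynomial σ K) :
    ∃ F : MvPolynomial σ k, ∀ ω : σ → k, eval ω F = ψ (eval (algebraMap k K ∘ ω) E) := by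
  refine ⟨∑ m ∈ E.support, monomial m (ψ (coeff m E)), fun ω => ?_⟩
  rw [map_sum, eval_eq (f := E), map_sum]
  refine Finset.sum_congr rfl fun m _ => ?_
  rw [eval_monomial, Finsupp.prod, mul_comm (coeff m E)]
  simp only [Function.comp_apply, ← map_pow, ← map_prod]
  rw [← Algebra.smul_def, map_smul, smul_eq_mul, mul_comm]

theorem eval_aeval_eq_eval (s : τ → k) (p : σ → MvPolynomial τ k) (F : MvPolynomial σ k) :
    eval s (aeval p F) = eval (fun j => eval s (p j)) F := by
  rw [aeval_eq_bind₁, ← coe_aeval_eq_eval, RingHom.coe_coe, aeval_bind₁]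
  rfl

/-- Tested against the linear functionals on `K`, independence over `k` becomes the non-vanishing
of a minor with entries in `k[ω]`, and `p` exhibits a minor that is not identically zero. -/
theorem exists_forall_linearIndependent_eval [Fintype ι] (E : ι → MvPolynomial σ K)
    (p : σ → MvPolynomial τ k)
    (h : ∀ c : ι → MvPolynomial τ k, (∀ s : τ → k,
      ∑ i, eval s (c i) • eval (algebraMap k K ∘ fun j => eval s (p j)) (E i) = 0) → c = 0) :
    ∃ G : MvPolynomial σ k, G ≠ 0 ∧ ∀ ω, eval ω G ≠ 0 →
      LinearIndependent k fun i => eval (algebraMap k K ∘ ω) (E i) := by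
  choose F hF using fun i (ψ : Dual k K) => exists_forall_eval_eq ψ (E i)
  have hind : LinearIndependent (MvPolynomial τ k) fun i ψ => aeval p (F i ψ) := by
    refine Fintype.linearIndependent_iff.2 fun c hc => congrFun (h c fun s => ?_)
    rw [← Module.forall_dual_apply_eq_zero_iff k]
    intro ψ
    have hs := congrArg (eval s) (congrFun hc ψ)
    simp only [Finset.sum_apply, Pi.smul_apply, smul_eq_mul, map_sum, map_mul, eval_aeval_eq_eval,
      hF, Pi.zero_apply, map_zero] at hs
    simpa only [map_sum, map_smul, smul_eq_mul] using hs
  let u := (Fintype.equivFin ι).symm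
  obtain ⟨ψ, hψ⟩ := exists_det_ne_zero_of_linearIndependent _ (hind.comp u u.injective)
  let A : Matrix _ _ (MvPolynomial σ k) := Matrix.of fun i j => F (u i) (ψ j)
  refine ⟨A.det, fun hA => hψ ?_, fun ω hω => ?_⟩
  · exact (AlgHom.map_det (aeval p) A).symm.trans ((congrArg (aeval p) hA).trans (map_zero _))
  · rw [RingHom.map_det] at hω
    have hrows : LinearIndependent k fun i (ψ : Dual k K) => eval ω (F (u i) ψ) :=
      linearIndependent_of_det_ne_zero ψ hω
    simp only [hF] at hrows
    rw [← linearIndependent_equiv u]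
    exact .of_comp (LinearMap.pi fun ψ : Dual k K => ψ) hrows

end GenericIndependence

section Pencil

/-! ### The pencil of hyperplanes through the intersection of two coordinate hyperplanes -/

variable {k σ : Type*} [Field k]

theorem le_degreeOf_of_eval_single_ne_zero [DecidableEq σ] {f : MvPolynomial σ k} {d : ℕ} {o : σ}
    (hf : f.IsHomogeneous d) (h : eval (Pi.single o 1) f ≠ 0) : d ≤ degreeOf o f := by
  rw [eval_eq] at h
  obtain ⟨m, hm, hne⟩ := Finset.exists_ne_zero_of_sum_ne_zero h
  have hmo : m = Finsupp.single o (m o) := by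
    refine (Finsupp.support_subset_singleton.1 fun i hi => Finset.mem_singleton.2 ?_)
    by_contra hio
    refine hne (mul_eq_zero_of_right _ (Finset.prod_eq_zero hi ?_))
    rw [Pi.single_eq_of_ne hio, zero_pow (Finsupp.mem_support_iff.1 hi)]
  have hmd : m.degree = d := (hf.degree_eq_sum_deg_support hm).symm
  rw [hmo, Finsupp.degree_single] at hmd
  exact hmd ▸ monomial_le_degreeOf o hm

theorem eq_zero_of_dvd_of_degreeOf_lt {f g : MvPolynomial σ k} {o : σ} (hdvd : f ∣ g)
    (hlt : degreeOf o g < degreeOf o f) : g = 0 := by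
  obtain ⟨q, rfl⟩ := hdvd
  by_contra hne
  rw [degreeOf_mul_eq (left_ne_zero_of_mul hne) (right_ne_zero_of_mul hne)] at hlt
  lia

theorem injOn_erase_of_degree_eq (b : σ) (d : ℕ) :
    Set.InjOn (fun μ : σ →₀ ℕ => μ.erase b) {μ | μ.degree = d} := by
  intro μ hμ ν hν (h : μ.erase b = ν.erase b)
  have hdeg (μ : σ →₀ ℕ) : μ b + (μ.erase b).degree = μ.degree := by
    conv_rhs => rw [← Finsupp.single_add_erase b μ, map_add, Finsupp.degree_single]
  have hb : μ b = ν b := by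
    have h1 := hdeg μ
    have h2 := hdeg ν
    rw [hμ, h] at h1
    rw [hν] at h2
    lia
  rw [← Finsupp.single_add_erase b μ, ← Finsupp.single_add_erase b ν, h, hb]

variable {a : σ} {d : ℕ} {S : Finset ({i // i ≠ a} →₀ ℕ)}

theorem eq_zero_of_sum_rename_mul_rename_monomial_eq_zero (b : {i // i ≠ a})
    (hS : ∀ μ ∈ S, μ.degree = d) (c : S → MvPolynomial (Fin 2) k)
    (h : ∑ μ, rename ![a, b] (c μ) * rename Subtype.val (monomial μ.1 (1 : k)) = 0) : c = 0 := by
  classical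
  let x : σ → MvPolynomial {i // i ≠ a} (MvPolynomial (Fin 2) k) := fun i =>
    if hi : i = a then C (X 0) else if i = b then C (X 1) else X ⟨i, hi⟩
  have hx_coeff (q : MvPolynomial (Fin 2) k) : aeval x (rename ![a, b] q) = C q := by
    have hcomp : (aeval x).comp (rename ![a, b]) =
        IsScalarTower.toAlgHom k (MvPolynomial (Fin 2) k) (MvPolynomial {i // i ≠ a} _) := by
      ext1 i
      fin_cases i <;> simp [x, b.2, algebraMap_eq]
    exact DFunLike.congr_fun hcomp q
  have hx_monomial (μ : {i // i ≠ a} →₀ ℕ) : aeval x (rename Subtype.val (monomial μ (1 : k))) =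
      C (X 1 ^ μ b) * monomial (μ.erase b) 1 := by
    have hxb : x b = C (X 1) := by simp [x, b.2]
    rw [aeval_rename, aeval_monomial, map_one, one_mul,
      ← Finsupp.mul_prod_erase' μ b _ fun _ => pow_zero _, Function.comp_apply, hxb, C_pow,
      monomial_eq, C_1, one_mul]
    congr 1
    refine Finsupp.prod_congr fun i hi => ?_
    have hib : i ≠ b := fun h => Finsupp.mem_support_iff.1 hi (h ▸ Finsupp.erase_same)
    simp [x, i.2, Subtype.coe_ne_coe.2 hib]
  have hind := (basisMonomials {i // i ≠ a} (MvPolynomial (Fin 2) k)).linearIndependent.comp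
    (fun μ : S => μ.1.erase b) fun μ ν hμν =>
      Subtype.ext (injOn_erase_of_degree_eq b d (hS μ μ.2) (hS ν ν.2) hμν)
  have hrel := congrArg (aeval x) h
  simp only [map_sum, map_mul, hx_coeff, hx_monomial, map_zero, ← mul_assoc] at hrel
  ext1 μ
  have hμ := Fintype.linearIndependent_iff.1 hind (fun μ => c μ * X 1 ^ μ.1 b)
    (by simpa only [Function.comp_apply, coe_basisMonomials, smul_eq_C_mul, C_mul] using hrel) μ
  exact (mul_eq_zero.1 hμ).resolve_right (pow_ne_zero _ (X_ne_zero _))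

/-- The relation among the forms in `x e + y f` is the vanishing on the pencil of a polynomial whose
degree in the variable `o` is less than that of `Υ`. -/
theorem eq_zero_of_forall_pencil {K : Type*} [Field K] [Algebra k K] {e f : σ → K}
    {b : {i // i ≠ a}} {o : σ} (hoa : o ≠ a) (hob : o ≠ b) (hea : e a = 1) (heb : e b = 0)
    (hfa : f a = 0) (hfb : f b = 1) {Υ : MvPolynomial σ k}
    (hΥ : ∀ H, (∀ s : Fin 2 → k, aeval (s 0 • e + s 1 • f) H = 0) → Υ ∣ H)
    (hd : d < degreeOf o Υ) (hS : ∀ μ ∈ S, μ.degree = d) (c : S → MvPolynomial (Fin 2) k)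
    (hc : ∀ s : Fin 2 → k, ∑ μ, eval s (c μ) •
      aeval ((s 0 • e + s 1 • f) ∘ Subtype.val) (monomial μ.1 (1 : k)) = 0) : c = 0 := by
  refine eq_zero_of_sum_rename_mul_rename_monomial_eq_zero b hS c
    (eq_zero_of_dvd_of_degreeOf_lt (o := o) (hΥ _ fun s => ?_) (lt_of_le_of_lt ?_ hd))
  · have hab : (s 0 • e + s 1 • f) ∘ ![a, b] = algebraMap k K ∘ s := by
      ext1 i
      fin_cases i <;> simp [hea, heb, hfa, hfb, Algebra.smul_def]
    rw [map_sum, ← hc s]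
    refine Finset.sum_congr rfl fun μ _ => ?_
    rw [map_mul, aeval_rename, aeval_rename, hab, aeval_algebraMap_apply, ← Algebra.smul_def]
    rfl
  · refine (degreeOf_sum_le _ _ _).trans (Finset.sup_le fun μ _ => ?_)
    have hcoeff : degreeOf o (rename ![a, b] (c μ)) = 0 := by
      classical
      by_contra hne
      obtain ⟨i, -, hi⟩ := mem_vars_rename _ _ (mem_vars_iff_degreeOf_ne_zero.2 hne)
      fin_cases i
      exacts [hoa hi.symm, hob hi.symm]
    calc _ ≤ _ := degreeOf_mul_le _ _ _
      _ ≤ 0 + totalDegree (monomial μ.1 (1 : k)) :=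
        add_le_add hcoeff.le ((degreeOf_le_totalDegree _ _).trans (totalDegree_rename_le _ _))
      _ ≤ d := by
        rw [zero_add, ← hS μ μ.2]
        exact totalDegree_monomial_le _ _

end Pencil

section HyperplaneSections

/-! ### Forms vanishing on a generic hyperplane section -/

variable {k K σ : Type*} [Field k] [Field K] [Algebra k K]

theorem eq_zero_of_aeval_eq_zero_of_support_subset {A : Type*} [CommRing A] [Algebra k A]
    {x : σ → A} {S : Finset (σ →₀ ℕ)}
    (hx : LinearIndependent k fun μ : S => aeval x (monomial μ.1 (1 : k)))
    {g : MvPolynomial σ k} (hg : g.support ⊆ S) (h : aeval x g = 0) : g = 0 := by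
  have hsum : g = ∑ μ : S, coeff μ.1 g • monomial μ.1 1 := by
    conv_lhs => rw [g.as_sum, Finset.sum_subset hg fun μ _ hμ => by
      rw [notMem_support_iff.1 hμ, monomial_zero]]
    simp only [smul_monomial, smul_eq_mul, mul_one]
    exact (Finset.sum_coe_sort S fun μ => monomial μ (coeff μ g)).symm
  rw [hsum, map_sum] at h
  simp only [map_smul] at h
  rw [hsum]
  exact Finset.sum_eq_zero fun μ _ => by rw [Fintype.linearIndependent_iff.1 hx _ h μ, zero_smul]

theorem eq_zero_of_comp_val_eq_zero [DecidableEq σ] {N : Submodule K (σ → K)}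
    {Υ : MvPolynomial σ k} {o : σ} (ho : eval (Pi.single o 1) Υ ≠ 0)
    (hΥ : Υ ∈ vanishingIdeal k (N : Set (σ → K))) {x : σ → K} (hx : x ∈ N)
    (h : x ∘ (Subtype.val : {i // i ≠ o} → σ) = 0) : x = 0 := by
  have hxo : x = x o • (algebraMap k K ∘ Pi.single o 1) := by
    ext1 i
    by_cases hi : i = o
    · simp [hi]
    · simpa [hi] using congrFun h ⟨i, hi⟩
  by_contra hx0
  rw [hxo, N.smul_mem_iff fun h0 => hx0 (by rw [hxo, h0, zero_smul])] at hx
  have h0 := hΥ _ hx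
  rw [aeval_algebraMap_apply, map_eq_zero] at h0
  exact ho h0

variable [Fintype σ]

/-- Whether the forms of degree `d` on the hyperplane `ω⊥` are determined by their values on its
section of `N`, a subspace over the larger field `K`. -/
def SectionDetectsForms (N : Submodule K (σ → K)) (d : ℕ) (ω : σ → k) : Prop :=
  ∀ g : MvPolynomial σ k, g.IsHomogeneous d →
    (∀ a ∈ N, a ⬝ᵥ (algebraMap k K ∘ ω) = 0 → aeval a g = 0) → ∀ c, c ⬝ᵥ ω = 0 → eval c g = 0

theorem exists_mulVec_comp_val_eq [DecidableEq σ] (K : Type*) [Field K] [Algebra k K] {ω : σ → k}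
    {a : σ} (ha : ω a ≠ 0) : ∃ R : Matrix σ {i // i ≠ a} k, ∀ x : σ → K,
      x ⬝ᵥ (algebraMap k K ∘ ω) = 0 → (R.map (algebraMap k K)).mulVec (x ∘ Subtype.val) = x := by
  refine ⟨Matrix.of fun i j => if i = a then -ω j / ω a else if i = j then 1 else 0,
    fun x hx => ?_⟩
  ext1 i
  by_cases hi : i = a
  · subst hi
    have ha' : algebraMap k K (ω i) ≠ 0 := (map_ne_zero _).2 ha
    rw [dotProduct, Fintype.sum_eq_add_sum_subtype_ne _ i] at hx
    simp only [Matrix.mulVec, dotProduct, Matrix.map_apply, Matrix.of_apply, if_true, map_div₀,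
      map_neg, Function.comp_apply] at hx ⊢
    rw [← mul_right_inj' ha', Finset.mul_sum, mul_comm _ (x i), eq_neg_of_add_eq_zero_left hx,
      ← Finset.sum_neg_distrib]
    refine Finset.sum_congr rfl fun j _ => ?_
    field_simp
  · simp only [Matrix.mulVec, dotProduct, Matrix.map_apply, Matrix.of_apply, if_neg hi,
      Function.comp_apply]
    rw [Finset.sum_eq_single ⟨i, hi⟩]
    · simp
    · intro j _ hj
      rw [if_neg fun h => hj (Subtype.ext h.symm), map_zero, zero_mul]
    · exact fun h => absurd (Finset.mem_univ _) h

theorem sectionDetectsForms_of_linearIndependent {N : Submodule K (σ → K)} {d : ℕ} {ω : σ → k}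
    {a : σ} (ha : ω a ≠ 0) {x : σ → K} (hx : x ∈ N) (hxω : x ⬝ᵥ (algebraMap k K ∘ ω) = 0)
    {S : Finset ({i // i ≠ a} →₀ ℕ)} (hS : ∀ μ, μ.degree = d → μ ∈ S)
    (hind : LinearIndependent k fun μ : S => aeval (x ∘ Subtype.val) (monomial μ.1 (1 : k))) :
    SectionDetectsForms N d ω := by
  classical
  intro g hg hgN c hc
  obtain ⟨R, hR⟩ := exists_mulVec_comp_val_eq K ha
  have hRg : pullback R g = 0 := by
    refine eq_zero_of_aeval_eq_zero_of_support_subset hind (fun μ hμ => ?_) ?_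
    · refine hS μ (of_not_not fun hne => mem_support_iff.1 hμ ?_)
      exact (isHomogeneous_pullback R hg).coeff_eq_zero hne
    · rw [aeval_pullback, hR x hxω]
      exact hgN x hx hxω
  have hcK : (algebraMap k K ∘ c) ⬝ᵥ (algebraMap k K ∘ ω) = 0 := by
    rw [← RingHom.map_dotProduct, hc, map_zero]
  have h := congrArg (aeval ((algebraMap k K ∘ c) ∘ Subtype.val)) hRg
  rw [aeval_pullback, hR _ hcK, aeval_algebraMap_apply, map_zero] at h
  exact (map_eq_zero _).1 h

theorem exists_forall_sectionDetectsForms_of_pencil {N : Submodule K (σ → K)}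
    {e f : σ → K} (he : e ∈ N) (hf : f ∈ N) {a : σ} {b : {i // i ≠ a}} {o : σ} (hoa : o ≠ a)
    (hob : o ≠ b) (hea : e a = 1) (heb : e b = 0) (hfa : f a = 0) (hfb : f b = 1)
    {Υ : MvPolynomial σ k}
    (hΥ : ∀ H, (∀ s : Fin 2 → k, aeval (s 0 • e + s 1 • f) H = 0) → Υ ∣ H) {d : ℕ}
    (hd : d < degreeOf o Υ) : ∃ G : MvPolynomial σ k, G ≠ 0 ∧ ∀ ω, eval ω G ≠ 0 →
      SectionDetectsForms N d ω := by
  classical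
  let β (i : σ) : MvPolynomial σ K := C (e i) * linearForm f - C (f i) * linearForm e
  have hβ (ω : σ → K) : (fun i => eval ω (β i)) = (f ⬝ᵥ ω) • e - (e ⬝ᵥ ω) • f := by
    ext1 i
    simp only [β, map_sub, map_mul, eval_C, eval_linearForm, Pi.sub_apply, Pi.smul_apply,
      smul_eq_mul]
    ring
  let S : Finset ({i // i ≠ a} →₀ ℕ) := (Finsupp.finite_of_degree_eq d).toFinset
  have hS (μ) : μ ∈ S ↔ μ.degree = d := Set.Finite.mem_toFinset _
  let E (μ : S) : MvPolynomial σ K := aeval (β ∘ Subtype.val) (monomial μ.1 (1 : k))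
  have hE (ω : σ → K) (μ : S) : eval ω (E μ) =
      aeval (((f ⬝ᵥ ω) • e - (e ⬝ᵥ ω) • f) ∘ Subtype.val) (monomial μ.1 (1 : k)) := by
    rw [← hβ]
    simp [E, aeval_monomial, Finsupp.prod]
  let p : σ → MvPolynomial (Fin 2) k := Pi.single b.1 (X 0) - Pi.single a (X 1)
  have hp (s : Fin 2 → k) : (f ⬝ᵥ (algebraMap k K ∘ fun j => eval s (p j))) • e -
      (e ⬝ᵥ (algebraMap k K ∘ fun j => eval s (p j))) • f = s 0 • e + s 1 • f := by
    have hpK : (algebraMap k K ∘ fun j => eval s (p j)) =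
        Pi.single b.1 (algebraMap k K (s 0)) - Pi.single a (algebraMap k K (s 1)) := by
      ext1 i
      simp [p, Pi.single_apply, apply_ite (eval s), apply_ite (algebraMap k K)]
    rw [hpK, dotProduct_sub, dotProduct_sub]
    simp [hea, heb, hfa, hfb]
  obtain ⟨G, hG, h⟩ := exists_forall_linearIndependent_eval E p fun c hc =>
    eq_zero_of_forall_pencil hoa hob hea heb hfa hfb hΥ hd (fun μ => (hS μ).1) c fun s => by
      simpa only [hE, hp] using hc s
  refine ⟨G * X a, mul_ne_zero hG (X_ne_zero a), fun ω hω => ?_⟩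
  rw [map_mul, eval_X, mul_ne_zero_iff] at hω
  refine sectionDetectsForms_of_linearIndependent hω.2
    (N.sub_mem (N.smul_mem _ he) (N.smul_mem _ hf)) ?_
    (fun μ => (hS μ).2) (by simpa only [hE] using h ω hω.1)
  rw [sub_dotProduct, smul_dotProduct, smul_dotProduct, smul_eq_mul, smul_eq_mul, mul_comm,
    sub_self]

theorem SectionDetectsForms.of_comap {τ : Type*} [Fintype τ] {N : Submodule K (σ → K)} {d : ℕ}
    {ω : σ → k} {A : Matrix σ τ k} (hA : Function.Surjective A.mulVec) (h : SectionDetectsForms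
      (N.comap (A.map (algebraMap k K)).mulVecLin) d (A.transpose.mulVec ω)) :
    SectionDetectsForms N d ω := by
  intro g hg hgN c hc
  obtain ⟨c, rfl⟩ := hA c
  rw [← eval_pullback]
  refine h _ (isHomogeneous_pullback A hg) (fun x hx hxω => ?_) _ ?_
  · have hAω : algebraMap k K ∘ A.transpose.mulVec ω =
        (A.map (algebraMap k K)).transpose.mulVec (algebraMap k K ∘ ω) :=
      funext (RingHom.map_mulVec _ _ _)
    rw [aeval_pullback]
    refine hgN _ hx ?_
    rwa [hAω, Matrix.dotProduct_mulVec, Matrix.vecMul_transpose] at hxω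
  · rwa [Matrix.dotProduct_mulVec, Matrix.vecMul_transpose]

theorem finrank_comap_mulVecLin [DecidableEq σ] {A B : Matrix σ σ K} (hAB : A * B = 1)
    (N : Submodule K (σ → K)) : finrank K (N.comap A.mulVecLin) = finrank K N := by
  have h := (Matrix.toLin'OfInv (mul_eq_one_comm.1 hAB) hAB).symm.finrank_map_eq N
  rwa [Submodule.map_equiv_eq_comap_symm] at h

theorem vanishingIdeal_comap_mulVecLin [DecidableEq σ] {A B : Matrix σ σ k}
    (hAB : A * B = 1) (N : Submodule K (σ → K)) :
    vanishingIdeal k (N.comap (A.map (algebraMap k K)).mulVecLin : Set (σ → K)) =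
      (vanishingIdeal k (N : Set (σ → K))).map (pullback A) := by
  have hABK : A.map (algebraMap k K) * B.map (algebraMap k K) = 1 := by
    rw [← Matrix.map_mul, hAB, Matrix.map_one _ (map_zero _) (map_one _)]
  apply le_antisymm
  · intro f hf
    have hBf : pullback B f ∈ vanishingIdeal k (N : Set (σ → K)) := fun a ha => by
      rw [aeval_pullback]
      refine hf _ ?_
      rwa [SetLike.mem_coe, Submodule.mem_comap, Matrix.mulVecLin_apply, Matrix.mulVec_mulVec,
        hABK, Matrix.one_mulVec]
    have h := Ideal.mem_map_of_mem (pullback A) hBf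
    rwa [pullback_pullback, mul_eq_one_comm.1 hAB, pullback_one] at h
  · rw [Ideal.map_le_iff_le_comap]
    intro f hf a ha
    exact (aeval_pullback A f a).trans (hf _ ha)

theorem exists_mul_eq_one_and_mulVec_single [DecidableEq σ] {z : σ → k} {o : σ}
    (ho : z o ≠ 0) : ∃ A B : Matrix σ σ k, A * B = 1 ∧ A.mulVec (Pi.single o 1) = z := by
  have hdet : (Matrix.updateCol (1 : Matrix σ σ k) o z).det = z o := by
    rw [← Matrix.cramer_apply, Matrix.cramer_one]
    rfl
  refine ⟨Matrix.updateCol 1 o z, _, Matrix.mul_nonsing_inv _ (by rwa [hdet, isUnit_iff_ne_zero]),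
    ?_⟩
  rw [Matrix.mulVec_single_one]
  ext1 i
  simp

variable {N : Submodule K (σ → K)} {Υ : MvPolynomial σ k}
  [Infinite k] {D d : ℕ}

theorem exists_forall_sectionDetectsForms_of_eval_single_ne_zero [DecidableEq σ]
    (hN : finrank K N = 2) (hI : vanishingIdeal k (N : Set (σ → K)) = Ideal.span {Υ})
    (hΥ : Υ.IsHomogeneous D) {o : σ} (ho : eval (Pi.single o 1) Υ ≠ 0) (hd : d < D) :
    ∃ G : MvPolynomial σ k, G ≠ 0 ∧ ∀ ω, eval ω G ≠ 0 → SectionDetectsForms N d ω := by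
  have hΥN : Υ ∈ vanishingIdeal k (N : Set (σ → K)) := hI ▸ Ideal.mem_span_singleton_self Υ
  obtain ⟨c, e, hce, he⟩ := exists_reduced_basis hN (Subtype.val : {i // i ≠ o} → σ)
    fun x => eq_zero_of_comp_val_eq_zero ho hΥN
  have hc : (c 1 : σ) ≠ c 0 := fun h => by
    have h01 := hce 0 1
    rw [h, hce] at h01
    simp at h01
  have hmem (i) : e i ∈ N := he ▸ Submodule.subset_span (Set.mem_range_self i)
  refine exists_forall_sectionDetectsForms_of_pencil (hmem 0) (hmem 1) (b := ⟨c 1, hc⟩)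
    (c 0).2.symm (c 1).2.symm (by simp [hce]) (by simp [hce]) (by simp [hce]) (by simp [hce])
    (fun H hH => ?_) (hd.trans_le (le_degreeOf_of_eval_single_ne_zero hΥ ho))
  rw [← Ideal.mem_span_singleton, ← hI, ← he, ← Submodule.span_span_of_tower k,
    vanishingIdeal_span_submodule]
  intro x hx
  obtain ⟨s, rfl⟩ := Submodule.mem_span_range_iff_exists_fun k |>.1 hx
  rw [Fin.sum_univ_two]
  exact hH s

theorem exists_forall_sectionDetectsForms (hN : finrank K N = 2)
    (hI : vanishingIdeal k (N : Set (σ → K)) = Ideal.span {Υ}) (hΥ : Υ.IsHomogeneous D)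
    (hΥ0 : Υ ≠ 0) (hd : d < D) :
    ∃ G : MvPolynomial σ k, G ≠ 0 ∧ ∀ ω, eval ω G ≠ 0 → SectionDetectsForms N d ω := by
  classical
  obtain ⟨z, hz⟩ : ∃ z, eval z Υ ≠ 0 := not_forall.1 fun h => hΥ0 (MvPolynomial.funext h)
  obtain ⟨o, ho⟩ : ∃ o, z o ≠ 0 := Function.ne_iff.1 fun h => hz <| by
    rw [h, eval_zero', constantCoeff_eq]
    exact hΥ.coeff_eq_zero (by simpa using hd.ne_bot.symm)
  obtain ⟨A, B, hAB, hAz⟩ := exists_mul_eq_one_and_mulVec_single ho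
  have hABK : A.map (algebraMap k K) * B.map (algebraMap k K) = 1 := by
    rw [← Matrix.map_mul, hAB, Matrix.map_one _ (map_zero _) (map_one _)]
  obtain ⟨G, hG, h⟩ := exists_forall_sectionDetectsForms_of_eval_single_ne_zero
    ((finrank_comap_mulVecLin hABK N).trans hN)
    (by rw [vanishingIdeal_comap_mulVecLin hAB, hI, Ideal.map_span, Set.image_singleton])
    (isHomogeneous_pullback A hΥ) (by rwa [eval_pullback, hAz]) hd
  refine ⟨pullback A.transpose G, ?_, fun ω hω =>
    .of_comap (fun v => ⟨B.mulVec v, ?_⟩) (h _ (by rwa [eval_pullback] at hω))⟩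
  · rw [map_ne_zero_iff _ (pullback_injective (B := B.transpose) ?_)]
    · exact hG
    rw [← Matrix.transpose_mul, mul_eq_one_comm.1 hAB, Matrix.transpose_one]
  · rw [Matrix.mulVec_mulVec, hAB, Matrix.one_mulVec]

theorem exists_forall_lt_sectionDetectsForms (hN : finrank K N = 2)
    (hI : vanishingIdeal k (N : Set (σ → K)) = Ideal.span {Υ}) (hΥ : Υ.IsHomogeneous D)
    (hΥ0 : Υ ≠ 0) :
    ∃ G : MvPolynomial σ k, G ≠ 0 ∧ ∀ ω, eval ω G ≠ 0 → ∀ d < D, SectionDetectsForms N d ω := by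
  choose! G hG h using fun d (hd : d < D) =>
    exists_forall_sectionDetectsForms hN hI hΥ hΥ0 hd
  refine ⟨∏ d ∈ Finset.range D, G d, Finset.prod_ne_zero_iff.2 fun d hd =>
    hG d (Finset.mem_range.1 hd), fun ω hω d hd => h d hd ω ?_⟩
  rw [map_prod, Finset.prod_ne_zero_iff] at hω
  exact hω d (Finset.mem_range.2 hd)

theorem exists_forall_exists_dotProduct_eq_zero [Nontrivial σ] (hΥ : Υ ≠ 0) :
    ∃ G : MvPolynomial σ k, G ≠ 0 ∧ ∀ ω, eval ω G ≠ 0 → ∃ c, c ⬝ᵥ ω = 0 ∧ eval c Υ ≠ 0 := by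
  classical
  obtain ⟨z, hz⟩ : ∃ z, eval z Υ ≠ 0 := not_forall.1 fun h => hΥ (MvPolynomial.funext h)
  obtain ⟨ω, hω, hω0⟩ : ∃ ω ∈ perp (Submodule.span k {z}), ω ≠ 0 := by
    refine Submodule.exists_mem_ne_zero_of_ne_bot fun h => ?_
    have hcard := finrank_perp (Submodule.span k {z})
    rw [h, finrank_bot] at hcard
    have : finrank k (Submodule.span k {z}) ≤ 1 := by simpa using finrank_span_le_card (R := k) {z}
    have := Fintype.one_lt_card (α := σ)
    lia
  obtain ⟨i, hi⟩ := Function.ne_iff.1 hω0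
  let u : σ → k := Pi.single i (ω i)⁻¹
  have hzω : z ⬝ᵥ ω = 0 := mem_perp.1 hω z (Submodule.mem_span_singleton_self z)
  have huω : u ⬝ᵥ ω = 1 := by rw [single_dotProduct, inv_mul_cancel₀ hi]
  have hmul (ω : σ → k) : (Matrix.vecMulVec z u - Matrix.vecMulVec u z).mulVec ω =
      (u ⬝ᵥ ω) • z - (z ⬝ᵥ ω) • u := by
    ext1 j
    simp [Matrix.sub_mulVec, Matrix.vecMulVec_mulVec, mul_comm]
  refine ⟨pullback (Matrix.vecMulVec z u - Matrix.vecMulVec u z) Υ, fun h => hz ?_, fun ω hω =>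
    ⟨(u ⬝ᵥ ω) • z - (z ⬝ᵥ ω) • u, ?_, by rwa [eval_pullback, hmul] at hω⟩⟩
  · rw [← map_zero (eval ω), ← h, eval_pullback, hmul, hzω, huω, one_smul, zero_smul, sub_zero]
  · rw [sub_dotProduct, smul_dotProduct, smul_dotProduct, smul_eq_mul, smul_eq_mul, mul_comm,
      sub_self]

end HyperplaneSections

section GenericCentre

/-! ### The class of the projection from a generic centre -/

section Degrees

variable {k K m n : Type*} [Field k] [Field K] [Algebra k K] [Fintype m] [Fintype n]
  [DecidableEq n] {M : Matrix m n k} {B : Matrix n m k} {o l : n → k} {N : Submodule K (n → K)}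

theorem totalDegree_le_of_vanishingIdeal_comap_eq_span (h : B * M + Matrix.vecMulVec o l = 1)
    {Υ : MvPolynomial n k} (hΥ : Υ.IsHomogeneous Υ.totalDegree)
    (hΥN : Υ ∈ vanishingIdeal k (N : Set (n → K))) (hΥo : ∃ c, c ⬝ᵥ o = 0 ∧ eval c Υ ≠ 0)
    {φ : MvPolynomial m k}
    (hφ : vanishingIdeal k (N.comap (M.map (algebraMap k K)).transpose.mulVecLin : Set (m → K)) =
      Ideal.span {φ}) :
    φ.totalDegree ≤ Υ.totalDegree := by
  have hdvd : φ ∣ pullback M.transpose Υ := by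
    rw [← Ideal.mem_span_singleton, ← hφ]
    intro b hb
    rw [aeval_pullback]
    exact hΥN _ hb
  have hne : pullback M.transpose Υ ≠ 0 := by
    obtain ⟨c, hc, hcΥ⟩ := hΥo
    contrapose! hcΥ
    rw [← transpose_mulVec_transpose_mulVec h hc, ← eval_pullback, hcΥ, map_zero]
  exact (totalDegree_le_of_dvd_of_isDomain hdvd hne).trans
    (isHomogeneous_pullback _ hΥ).totalDegree_le

theorem SectionDetectsForms.eq_zero_of_mem_vanishingIdeal_comap [Infinite k] [DecidableEq m]
    {d : ℕ} (hs : SectionDetectsForms N d o) (hMB : M * B = 1)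
    (h : B * M + Matrix.vecMulVec o l = 1) (hMo : M.mulVec o = 0) {φ : MvPolynomial m k}
    (hφ : φ.IsHomogeneous d) (hφN : φ ∈ vanishingIdeal k
      (N.comap (M.map (algebraMap k K)).transpose.mulVecLin : Set (m → K))) : φ = 0 := by
  have hBM : B.transpose * M.transpose = 1 := by
    rw [← Matrix.transpose_mul, hMB, Matrix.transpose_one]
  have hsection : ∀ c, c ⬝ᵥ o = 0 → eval c (pullback B.transpose φ) = 0 := by
    refine hs _ (isHomogeneous_pullback _ hφ) fun a ha hao => ?_
    rw [aeval_pullback]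
    refine hφN _ ?_
    rwa [SetLike.mem_coe, Submodule.mem_comap, Matrix.mulVecLin_apply, Matrix.transpose_map,
      transpose_mulVec_transpose_mulVec (map_mul_map_add_vecMulVec_eq_one (algebraMap k K) h) hao]
  refine MvPolynomial.funext fun b => ?_
  have hb : M.transpose.mulVec b ⬝ᵥ o = 0 := by
    rw [Matrix.mulVec_transpose, ← Matrix.dotProduct_mulVec, hMo, dotProduct_zero]
  simpa only [eval_pullback, Matrix.mulVec_mulVec, hBM, Matrix.one_mulVec, map_zero] using
    hsection _ hb

theorem totalDegree_eq_of_vanishingIdeal_comap_eq_span [Infinite k] [DecidableEq m]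
    (hMB : M * B = 1) (h : B * M + Matrix.vecMulVec o l = 1) (hMo : M.mulVec o = 0)
    {Υ : MvPolynomial n k} (hΥ : Υ.IsHomogeneous Υ.totalDegree)
    (hΥN : Υ ∈ vanishingIdeal k (N : Set (n → K))) (hΥo : ∃ c, c ⬝ᵥ o = 0 ∧ eval c Υ ≠ 0)
    (hs : ∀ d < Υ.totalDegree, SectionDetectsForms N d o) {φ : MvPolynomial m k} (hφ0 : φ ≠ 0)
    (hφ : φ.IsHomogeneous φ.totalDegree)
    (hφN : vanishingIdeal k (N.comap (M.map (algebraMap k K)).transpose.mulVecLin : Set (m → K)) =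
      Ideal.span {φ}) :
    φ.totalDegree = Υ.totalDegree := by
  refine (totalDegree_le_of_vanishingIdeal_comap_eq_span h hΥ hΥN hΥo hφN).antisymm ?_
  contrapose! hφ0
  exact (hs _ hφ0).eq_zero_of_mem_vanishingIdeal_comap hMB h hMo hφ
    (hφN ▸ Ideal.mem_span_singleton_self φ)

end Degrees

variable {K : Type*} [Field K] [Algebra ℂ K] {X : Set (PSpace 3)} {ξ : Fin 4 → K}
  {N : Submodule K (Fin 4 → K)} {Υ : MvPolynomial (Fin 4) ℂ} {M : Matrix (Fin 3) (Fin 4) ℂ}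
  {o : Fin 4 → ℂ}

/-- The open conditions on the coordinates `o` of a centre under which the projection of `X` has
class `deg Υ`, where `N` is the conormal space of `X` at its generic point and `Υ` is an equation
of the dual variety. -/
structure IsGenericCentre (X : Set (PSpace 3)) (N : Submodule K (Fin 4 → K))
    (Υ : MvPolynomial (Fin 4) ℂ) (o : Fin 4 → ℂ) : Prop where
  notMem_cone : o ∉ cone X
  exists_mem_dotProduct_ne_zero : ∃ a ∈ N, a ⬝ᵥ (algebraMap ℂ K ∘ o) ≠ 0
  dotProduct_ne_zero : ∀ w ≠ 0, linearForm w ∈ idealOf X → w ⬝ᵥ o ≠ 0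
  exists_eval_ne_zero : ∃ c, c ⬝ᵥ o = 0 ∧ eval c Υ ≠ 0
  sectionDetectsForms : ∀ d < Υ.totalDegree, SectionDetectsForms N d o

theorem IsGenericCentre.ne_zero (h : IsGenericCentre X N Υ o) : o ≠ 0 := by
  rintro rfl
  obtain ⟨a, -, ha⟩ := h.exists_mem_dotProduct_ne_zero
  exact ha (by simp [dotProduct])

theorem idealOf_dualVariety_projection (hX : IsIrreducibleCurve X)
    (hξ : idealOf X = vanishingIdeal ℂ {ξ}) (hK : Algebra.trdeg ℂ K = 2)
    (hM : LinearMap.ker M.mulVecLin = Submodule.span ℂ {o})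
    (ho : IsGenericCentre X (conormal (idealOf X) ξ) Υ o) :
    idealOf (dualVariety (projection M X)) =
      vanishingIdeal ℂ ((conormal (idealOf X) ξ).comap
        (M.map (algebraMap ℂ K)).transpose.mulVecLin : Set (Fin 3 → K)) := by
  obtain ⟨B, l, -, h⟩ :=
    exists_mul_eq_one_and_mul_add_vecMulVec_eq_one (surjective_mulVec_of_ker_eq_span hM) hM
  have hideal := idealOf_projection hM ho.notMem_cone
  have hdim := (isIrreducibleCurve_projection hX hM ho.ne_zero ho.notMem_cone).dim_eq_one
  have hker := disjoint_perp_ker_mulVecLin (map_mul_map_add_vecMulVec_eq_one (algebraMap ℂ K) h)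
    ho.exists_mem_dotProduct_ne_zero
  rw [idealOf_dualVariety hdim le_rfl (hideal.trans (vanishingIdeal_comap_pullback hξ M)), hideal,
    conormal_comap_pullback hξ hK hX.dim_eq_one (hideal ▸ hdim) hker]

theorem hasClass_projection (hX : IsIrreducibleCurve X) (hξ : idealOf X = vanishingIdeal ℂ {ξ})
    (hK : Algebra.trdeg ℂ K = 2) (hΥ : Υ.IsHomogeneous Υ.totalDegree)
    (hΥX : Υ ∈ idealOf (dualVariety X)) (hM : LinearMap.ker M.mulVecLin = Submodule.span ℂ {o})
    (ho : IsGenericCentre X (conormal (idealOf X) ξ) Υ o) :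
    HasClass (projection M X) Υ.totalDegree := by
  obtain ⟨B, l, hMB, h⟩ :=
    exists_mul_eq_one_and_mul_add_vecMulVec_eq_one (surjective_mulVec_of_ker_eq_span hM) hM
  have hMo : M.mulVec o = 0 := by
    have : o ∈ LinearMap.ker M.mulVecLin := hM ▸ Submodule.mem_span_singleton_self o
    exact this
  obtain ⟨φ, hφ0, hφ⟩ := exists_idealOf_dualVariety_eq_span_singleton
    (isIrreducibleCurve_projection hX hM ho.ne_zero ho.notMem_cone) le_rfl
    (not_isLine_projection hM ho.notMem_cone ho.dotProduct_ne_zero)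
  have hmin := isMinimalEquation_of_idealOf_eq_span_singleton (zariskiClosure_dualVariety _) hφ0 hφ
  rw [idealOf_dualVariety_projection hX hξ hK hM ho] at hφ
  rw [idealOf_dualVariety hX.dim_eq_one (by norm_num) hξ] at hΥX
  exact ⟨φ, hmin, totalDegree_eq_of_vanishingIdeal_comap_eq_span hMB h hMo hΥ hΥX
    ho.exists_eval_ne_zero ho.sectionDetectsForms hφ0 hmin.1.2.1 hφ⟩

theorem exists_forall_dotProduct_ne_zero {k K σ : Type*} [Field k] [Field K] [Algebra k K]
    [Fintype σ] {a : σ → K} (ha : a ≠ 0) :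
    ∃ w : σ → k, w ≠ 0 ∧ ∀ o, w ⬝ᵥ o ≠ 0 → a ⬝ᵥ (algebraMap k K ∘ o) ≠ 0 := by
  obtain ⟨i, hi⟩ := Function.ne_iff.1 ha
  obtain ⟨φ, hφ⟩ := not_forall.1 (mt (forall_dual_apply_eq_zero_iff k (a i)).1 hi)
  refine ⟨φ ∘ a, fun h => hφ (congrFun h i), fun o ho h => ho ?_⟩
  rw [← map_zero φ, ← h, dotProduct, dotProduct, map_sum]
  refine Finset.sum_congr rfl fun j _ => ?_
  rw [Function.comp_apply, Function.comp_apply, mul_comm (a j), ← Algebra.smul_def, map_smul,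
    smul_eq_mul, mul_comm]

theorem exists_forall_notMem_cone_and_exists_conormal (hN : conormal (idealOf X) ξ ≠ ⊥) :
    ∃ G : MvPolynomial (Fin 4) ℂ, G ≠ 0 ∧ ∀ o, eval o G ≠ 0 →
      o ∉ cone X ∧ ∃ a ∈ conormal (idealOf X) ξ, a ⬝ᵥ (algebraMap ℂ K ∘ o) ≠ 0 := by
  obtain ⟨f, hf, hfξ⟩ : ∃ f ∈ idealOf X, gradAt ξ f ≠ 0 := by
    contrapose! hN
    exact Submodule.span_eq_bot.2 (Set.forall_mem_image.2 hN)
  obtain ⟨w, hw, hwo⟩ := exists_forall_dotProduct_ne_zero (k := ℂ) hfξ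
  have hf0 : f ≠ 0 := by
    rintro rfl
    exact hfξ (map_zero _)
  refine ⟨f * linearForm w, mul_ne_zero hf0 (linearForm_ne_zero hw), fun o ho => ?_⟩
  rw [map_mul, mul_ne_zero_iff, eval_linearForm] at ho
  exact ⟨fun hoX => ho.1 (hf o hoX), _, Submodule.subset_span ⟨f, hf, rfl⟩, hwo o ho.2⟩

theorem exists_forall_linearForm_mem_idealOf (hX : IsIrreducibleCurve X) (hline : ¬ IsLine X) :
    ∃ G : MvPolynomial (Fin 4) ℂ, G ≠ 0 ∧ ∀ o, eval o G ≠ 0 →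
      ∀ w ≠ 0, linearForm w ∈ idealOf X → w ⬝ᵥ o ≠ 0 := by
  by_cases! h : ∃ u : Fin 4 → ℂ, u ≠ 0 ∧ linearForm u ∈ idealOf X
  · obtain ⟨u, hu, huX⟩ := h
    refine ⟨linearForm u, linearForm_ne_zero hu, fun o ho w hw hwX => ?_⟩
    rw [eval_linearForm] at ho
    obtain ⟨c, rfl⟩ : ∃ c : ℂ, c • u = w := by
      contrapose! hline
      refine isLine_of_linearForm_mem hX.closed hX.dim_eq_one (v := ![u, w]) rfl
        ((LinearIndependent.pair_iff' hu).2 hline) fun i => ?_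
      fin_cases i
      exacts [huX, hwX]
    rw [smul_dotProduct]
    exact smul_ne_zero (left_ne_zero_of_smul hw) ho
  · exact ⟨1, one_ne_zero, fun _ _ w hw hwX => absurd hwX (h w hw)⟩

theorem exists_forall_isGenericCentre (hX : IsIrreducibleCurve X) (hline : ¬ IsLine X)
    (hξ : idealOf X = vanishingIdeal ℂ {ξ}) (hK : Algebra.trdeg ℂ K = 2) (hΥ0 : Υ ≠ 0)
    (hΥ : Υ.IsHomogeneous Υ.totalDegree) (hΥX : idealOf (dualVariety X) = Ideal.span {Υ}) :
    ∃ G : MvPolynomial (Fin 4) ℂ, G ≠ 0 ∧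
      ∀ o, eval o G ≠ 0 → IsGenericCentre X (conormal (idealOf X) ξ) Υ o := by
  have hN : finrank K (conormal (idealOf X) ξ) = 2 := by
    have hperp := finrank_perp_conormal hξ hK hX.dim_eq_one
    rw [finrank_perp, Fintype.card_fin] at hperp
    lia
  rw [idealOf_dualVariety hX.dim_eq_one (by norm_num) hξ] at hΥX
  obtain ⟨G₁, hG₁, h₁⟩ := exists_forall_notMem_cone_and_exists_conormal (X := X) (ξ := ξ)
    (Submodule.one_le_finrank_iff.1 (hN ▸ one_le_two))
  obtain ⟨G₂, hG₂, h₂⟩ := exists_forall_linearForm_mem_idealOf hX hline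
  obtain ⟨G₃, hG₃, h₃⟩ := exists_forall_exists_dotProduct_eq_zero hΥ0
  obtain ⟨G₄, hG₄, h₄⟩ := exists_forall_lt_sectionDetectsForms hN hΥX hΥ hΥ0
  refine ⟨G₁ * G₂ * G₃ * G₄, by simp [*], fun o ho => ?_⟩
  simp only [map_mul, mul_ne_zero_iff, and_assoc] at ho
  obtain ⟨ho₁, ho₂, ho₃, ho₄⟩ := ho
  exact ⟨(h₁ o ho₁).1, (h₁ o ho₁).2, h₂ o ho₂, h₃ o ho₃, h₄ o ho₄⟩

theorem holdsGenerically_of_forall_smul_rep {n : ℕ} {P : PSpace n → Prop}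
    {G : MvPolynomial (Fin (n + 1)) ℂ} (hG : G ≠ 0)
    (h : ∀ (p : PSpace n) (c : ℂ), c ≠ 0 → eval (c • p.rep) G ≠ 0 → P p) :
    HoldsGenerically P := by
  obtain ⟨d, hd⟩ : ∃ d, homogeneousComponent d G ≠ 0 := by
    contrapose! hG
    rw [← sum_homogeneousComponent G]
    exact Finset.sum_eq_zero fun d _ => hG d
  have hhom := homogeneousComponent_isHomogeneous d G
  refine ⟨homogeneousComponent d G, hd, by rwa [hhom.totalDegree hd], fun p hp => ?_⟩
  contrapose! hp
  refine aeval_homogeneousComponent_eq_zero (k := ℂ) (fun c hc => ?_) d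
  contrapose! hp
  exact h p c hc hp

theorem HasCentre.ker_mulVecLin_eq {O : PSpace 3} (hM : HasCentre M O) {c : ℂ} (hc : c ≠ 0) :
    LinearMap.ker M.mulVecLin = Submodule.span ℂ {c • O.rep} := by
  rw [hM, Submodule.span_singleton_smul_eq hc.isUnit, Projectivization.submodule_eq]

end GenericCentre

end SpaceCurve

theorem mainTheorem9 (X : Set (SpaceCurve.PSpace 3)) (hX : SpaceCurve.IsIrreducibleCurve X)
    (hline : ¬ SpaceCurve.IsLine X) :
    ∃ m : ℕ,
      SpaceCurve.HoldsGenerically (fun O : SpaceCurve.PSpace 3 =>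
        O ∉ X ∧ ∀ M : Matrix (Fin 3) (Fin 4) ℂ, SpaceCurve.HasCentre M O →
          SpaceCurve.IsIrreducibleCurve (SpaceCurve.projection M X) ∧
          SpaceCurve.HasClass (SpaceCurve.projection M X) m) ∧
      (∃ Υ : MvPolynomial (Fin 4) ℂ,
        SpaceCurve.IsMinimalEquation Υ (SpaceCurve.dualVariety X)) ∧
      ∀ Υ : MvPolynomial (Fin 4) ℂ,
        SpaceCurve.IsMinimalEquation Υ (SpaceCurve.dualVariety X) → Υ.totalDegree = m := by
  open SpaceCurve in
  have := hX.irreducible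
  have hξ := (vanishingIdeal_genericPoint (idealOf X)).symm
  have hK := trdeg_functionField (idealOf X) hX.dim_eq_one
  obtain ⟨Υ, hΥ0, hΥ⟩ := exists_idealOf_dualVariety_eq_span_singleton hX (by norm_num) hline
  have hmin := isMinimalEquation_of_idealOf_eq_span_singleton (zariskiClosure_dualVariety X) hΥ0 hΥ
  have hhom : Υ.IsHomogeneous Υ.totalDegree := hmin.1.2.1
  refine ⟨Υ.totalDegree, ?_, ⟨Υ, hmin⟩, fun F hF => hF.totalDegree_eq hmin⟩
  obtain ⟨G, hG, hgeneric⟩ := exists_forall_isGenericCentre hX hline hξ hK hΥ0 hhom hΥ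
  refine holdsGenerically_of_forall_smul_rep hG fun O c hc hO => ?_
  have hO := hgeneric _ hO
  refine ⟨fun hOX => hO.notMem_cone (smul_mem_cone (rep_mem_cone.2 hOX) hc), fun M hM => ?_⟩
  have hker := hM.ker_mulVecLin_eq hc
  exact ⟨isIrreducibleCurve_projection hX hker hO.ne_zero hO.notMem_cone,
    hasClass_projection hX hξ hK hhom (hΥ ▸ Ideal.mem_span_singleton_self Υ) hker hO⟩
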